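/- **Definitions.** A (finite) argumentation framework is a pair $F=\langle A,R\rangle$ with $A$ a finite set of arguments and $R\subseteq A\times A$ a set of attacks. For $S\subseteq A$ let $S^+_F$ be the set of $a\in A$ attacked by some member of $S$; $S$ is conflict-free if $S\cap S^+_F=\emptyset$, and $\Gamma_F(S)$ is the set of $a\in A$ all of whose attackers are in $S^+_F$. A set $S\subseteq A$ is in $\mathtt{ad}(F)$ iff it is conflict-free and $S\subseteq\Gamma_F(S)$; in $\mathtt{st}(F)$ iff it is conflict-free and $S^+_F=A\setminus S$; in $\mathtt{co}(F)$ iff $S\in\mathtt{ad}(F)$ and $\Gamma_F(S)\subseteq S$. A set that is not contained in $A$ is in none of them. The verification status of $S$ in $F$ is $\sigma$-true if $S\in\sigma(F)$ and $\sigma$-false if $S\notin\sigma(F)$. A (finite) incomplete argumentation framework (IAF) is $I=\langle A,A^?,R,R^?\rangle$ with $A,A^?$ disjoint finite sets of (certain, uncertain) arguments and $R,R^?$ disjoint subsets of $(A\cup A^?)\times(A\cup A^?)$. An IAF $I'=\langle A',A'^?,R',R'^?\rangle$ is a partial completion of $I$ if $A\subseteq A'\subseteq A\cup A^?$, $R\cap\big((A'\cup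 A'^?)\times(A'\cup A'^?)\big)\subseteq R'\subseteq R\cup R^?$, $A'^?\subseteq A^?$ and $R'^?\subseteq R^?$. Let $cert(I)=\langle A,R\cap(A\times A)\rangle$. For an uncertain element $e\in A^?\cup R^?$, $I+\{e\}$ makes $e$ certain, and $I-\{e\}$ deletes $e$ (an argument together with all certain and uncertain attacks having it as an endpoint). For an IAF $I$, a set $S\subseteq A\cup A^?$, a verification status $j$ and $e\in A^?\cup R^?$, addition (resp. removal) of $e$ is $j$-relevant for $S$ w.r.t. $I$ if there is a partial completion $I'$ of $I$ whose only uncertain element is $e$, such that $S$ has status $j$ in $cert(I'+\{e\})$ (resp. $cert(I'-\{e\})$) but not in $cert(I'-\{e\})$ (resp. $cert(I'+\{e\})$). The problem $j$-RELEVANCE asks, given $I$, $S$, an action $\mathbf a\in\{\text{addition},\text{removal}\}$ and an uncertain element $e$ of $I$, whether $\mathbf a$ of $e$ is $j$-relevant for $S$ w.r.t. $I$. Here the arguments of $I$ are named by numbers in $\{0,\dots,n-1\}$, and an input is encoded in binary by the action, $n$ in unary, and the characteristic vectors and matrices of $A$, $A^?$, $S$, $R$, $R^?$ and $e$. **Corollary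 3.** For every $j\in\{\mathtt{ad},\mathtt{st},\mathtt{co}\}\times\{\text{true},\text{false}\}$, the problem $j$-RELEVANCE is in P: the language of encodings of its yes-instances is decided by a Turing machine in time polynomial in the length of the input word. -/

import Mathlib

namespace ArgFW

/-! ### Abstract argumentation frameworks -/

/-- A (finite) abstract argumentation framework: a finite set of arguments and a set of
attacks between them. -/
structure AF (V : Type) [DecidableEq V] where
  args : Finset V
  att : Finset (V × V)
  att_subset : att ⊆ args ×ˢ args

namespace AF

variable {V : Type} [DecidableEq V]

/-- `S⁺`: the arguments attacked by `S`. -/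
def plus (F : AF V) (S : Finset V) : Finset V :=
  F.args.filter fun a => ∃ b ∈ S, (b, a) ∈ F.att

/-- `S` is conflict-free. -/
def ConflictFree (F : AF V) (S : Finset V) : Prop :=
  S ∩ F.plus S = ∅

/-- `S` defends `a`: every attacker of `a` is attacked by `S`. -/
def Defends (F : AF V) (S : Finset V) (a : V) : Prop :=
  ∀ b ∈ F.args, (b, a) ∈ F.att → b ∈ F.plus S

instance (F : AF V) (S : Finset V) (a : V) : Decidable (F.Defends S a) := by
  unfold Defends; infer_instance

/-- The characteristic function: the arguments of `F` that `S` defends. -/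
def charFun (F : AF V) (S : Finset V) : Finset V :=
  F.args.filter fun a => F.Defends S a

end AF

/-- Admissible, stable and complete semantics. -/
inductive Semantics where
  | ad
  | st
  | co

/-- `S` is a `σ`-extension of `F`, that is, `S ∈ σ(F)`; extensions of `F` are sets of arguments
of `F`, so a set that is not contained in `F.args` is never one. -/
def IsExtension {V : Type} [DecidableEq V] (σ : Semantics) (F : AF V) (S : Finset V) : Prop :=
  S ⊆ F.args ∧
    match σ with
    | .ad => F.ConflictFree S ∧ S ⊆ F.charFun S
    | .st => F.ConflictFree S ∧ F.plus S = F.args \ S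
    | .co => (F.ConflictFree S ∧ S ⊆ F.charFun S) ∧ ∀ a ∈ F.charFun S, a ∈ S

/-- A verification status `σ`-true or `σ`-false. -/
structure Status where
  sem : Semantics
  val : Bool

/-- The verification status of `S` in `F` is `j`. -/
def HasStatus {V : Type} [DecidableEq V] (j : Status) (F : AF V) (S : Finset V) : Prop :=
  match j.val with
  | true => IsExtension j.sem F S
  | false => ¬ IsExtension j.sem F S

/-! ### Incomplete argumentation frameworks -/

/-- A (finite) incomplete argumentation framework `⟨A, A?, R, R?⟩`. -/
structure IAF (V : Type) [DecidableEq V] where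
  /-- certain arguments -/
  A : Finset V
  /-- uncertain arguments -/
  AQ : Finset V
  /-- certain attacks -/
  R : Finset (V × V)
  /-- uncertain attacks -/
  RQ : Finset (V × V)
  disjoint_args : Disjoint A AQ
  disjoint_atts : Disjoint R RQ
  R_subset : R ⊆ (A ∪ AQ) ×ˢ (A ∪ AQ)
  RQ_subset : RQ ⊆ (A ∪ AQ) ×ˢ (A ∪ AQ)

namespace IAF

variable {V : Type} [DecidableEq V]

/-- `I'` is a partial completion of `I`. -/
def IsPartialCompletion (I I' : IAF V) : Prop :=
  (I.A ⊆ I'.A ∧ I'.A ⊆ I.A ∪ I.AQ) ∧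
  (I.R ∩ ((I'.A ∪ I'.AQ) ×ˢ (I'.A ∪ I'.AQ)) ⊆ I'.R ∧ I'.R ⊆ I.R ∪ I.RQ) ∧
  I'.AQ ⊆ I.AQ ∧
  I'.RQ ⊆ I.RQ

/-- The framework on the certain part of `I`. -/
def cert (I : IAF V) : AF V where
  args := I.A
  att := I.R ∩ (I.A ×ˢ I.A)
  att_subset := Finset.inter_subset_right

/-- The set of uncertain elements: uncertain arguments `Sum.inl a` and uncertain attacks
`Sum.inr (a, b)`. -/
def uncertain (I : IAF V) : Finset (V ⊕ V × V) :=
  I.AQ.disjSum I.RQ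

/-- `I + R₀` for a set `R₀ ⊆ R?` of uncertain attacks (other members of `R₀` are ignored). -/
def addAttacks (I : IAF V) (R₀ : Finset (V × V)) : IAF V where
  A := I.A
  AQ := I.AQ
  R := I.R ∪ R₀ ∩ I.RQ
  RQ := I.RQ \ R₀
  disjoint_args := I.disjoint_args
  disjoint_atts := by
    have h := I.disjoint_atts
    rw [Finset.disjoint_left] at h ⊢
    intro x hx hx'
    simp only [Finset.mem_union, Finset.mem_inter, Finset.mem_sdiff] at hx hx'
    rcases hx with hx | hx
    · exact h hx hx'.1
    · exact hx'.2 hx.1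
  R_subset :=
    Finset.union_subset I.R_subset (Finset.inter_subset_right.trans I.RQ_subset)
  RQ_subset := Finset.sdiff_subset.trans I.RQ_subset

/-- `I - R₀` for a set `R₀ ⊆ R?` of uncertain attacks. -/
def removeAttacks (I : IAF V) (R₀ : Finset (V × V)) : IAF V where
  A := I.A
  AQ := I.AQ
  R := I.R
  RQ := I.RQ \ R₀
  disjoint_args := I.disjoint_args
  disjoint_atts := I.disjoint_atts.mono_right Finset.sdiff_subset
  R_subset := I.R_subset
  RQ_subset := Finset.sdiff_subset.trans I.RQ_subset

/-- `I + A₀` for a set `A₀ ⊆ A?` of uncertain arguments (other members of `A₀` are ignored). -/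
def addArgs (I : IAF V) (A₀ : Finset V) : IAF V where
  A := I.A ∪ A₀ ∩ I.AQ
  AQ := I.AQ \ A₀
  R := I.R
  RQ := I.RQ
  disjoint_args := by
    have h := I.disjoint_args
    rw [Finset.disjoint_left] at h ⊢
    intro x hx hx'
    simp only [Finset.mem_union, Finset.mem_inter, Finset.mem_sdiff] at hx hx'
    rcases hx with hx | hx
    · exact h hx hx'.1
    · exact hx'.2 hx.1
  disjoint_atts := I.disjoint_atts
  R_subset := by
    have e : I.A ∪ A₀ ∩ I.AQ ∪ I.AQ \ A₀ = I.A ∪ I.AQ := by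
      ext x; simp only [Finset.mem_union, Finset.mem_inter, Finset.mem_sdiff]; tauto
    rw [e]; exact I.R_subset
  RQ_subset := by
    have e : I.A ∪ A₀ ∩ I.AQ ∪ I.AQ \ A₀ = I.A ∪ I.AQ := by
      ext x; simp only [Finset.mem_union, Finset.mem_inter, Finset.mem_sdiff]; tauto
    rw [e]; exact I.RQ_subset

/-- `I - A₀` for a set `A₀ ⊆ A?` of uncertain arguments: they disappear together with all
attacks that have an endpoint in `A₀`. -/
def removeArgs (I : IAF V) (A₀ : Finset V) : IAF V where
  A := I.A
  AQ := I.AQ \ A₀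
  R := I.R \ (I.R ∪ I.RQ).filter fun r => r.1 ∈ A₀ ∨ r.2 ∈ A₀
  RQ := I.RQ \ (I.R ∪ I.RQ).filter fun r => r.1 ∈ A₀ ∨ r.2 ∈ A₀
  disjoint_args := I.disjoint_args.mono_right Finset.sdiff_subset
  disjoint_atts := I.disjoint_atts.mono Finset.sdiff_subset Finset.sdiff_subset
  R_subset := by
    intro r hr
    have h : r ∈ I.R → r ∈ (I.A ∪ I.AQ) ×ˢ (I.A ∪ I.AQ) := fun h => I.R_subset h
    simp only [Finset.mem_product, Finset.mem_union, Finset.mem_sdiff, Finset.mem_filter]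
      at hr h ⊢
    tauto
  RQ_subset := by
    intro r hr
    have h : r ∈ I.RQ → r ∈ (I.A ∪ I.AQ) ×ˢ (I.A ∪ I.AQ) := fun h => I.RQ_subset h
    simp only [Finset.mem_product, Finset.mem_union, Finset.mem_sdiff, Finset.mem_filter]
      at hr h ⊢
    tauto

/-- `I + {e}` for an uncertain element `e`. -/
def add (I : IAF V) : V ⊕ V × V → IAF V
  | .inl a => I.addArgs {a}
  | .inr r => I.addAttacks {r}

/-- `I - {e}` for an uncertain element `e`. -/
def remove (I : IAF V) : V ⊕ V × V → IAF V
  | .inl a => I.removeArgs {a}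
  | .inr r => I.removeAttacks {r}

end IAF

/-! ### Relevance -/

/-- The two actions on an uncertain element. -/
inductive Act where
  | addition
  | removal

/-- The result of performing an action on the element `e`. -/
def Act.apply {V : Type} [DecidableEq V] (c : Act) (I : IAF V) (e : V ⊕ V × V) : IAF V :=
  match c with
  | .addition => I.add e
  | .removal => I.remove e

/-- The opposite action. -/
def Act.opposite : Act → Act
  | .addition => .removal
  | .removal => .addition

/-- Action `c` on the uncertain element `e` is `j`-relevant for `S` with respect to `I`. -/
def Relevant {V : Type} [DecidableEq V] (j : Status) (I : IAF V) (S : Finset V) (c : Act)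
    (e : V ⊕ V × V) : Prop :=
  ∃ I' : IAF V, I.IsPartialCompletion I' ∧ I'.uncertain = {e} ∧
    HasStatus j (c.apply I' e).cert S ∧ ¬ HasStatus j (c.opposite.apply I' e).cert S

/-! ### The decision problem and the class P -/

/-- An input of the relevance problem. The arguments are named by numbers below `n`; every finite
framework is of this form up to the names of its arguments. -/
structure Input where
  n : ℕ
  I : IAF (Fin n)
  S : Finset (Fin n)
  S_subset : S ⊆ I.A ∪ I.AQ
  action : Act
  e : Fin n ⊕ Fin n × Fin n
  e_mem : e ∈ I.uncertain

/-- The bit telling the two actions apart. -/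
def Act.toBool : Act → Bool
  | .addition => true
  | .removal => false

/-- The binary encoding of an input: one bit for the action, `n` in unary closed by a `0`, then for
each argument name `i` four bits (is `i` a certain argument, an uncertain argument, a member of
`S`, the element in question), then for each pair of names, row by row, three bits (is it a
certain attack, an uncertain attack, the element in question). -/
def Input.encode (x : Input) : List Bool :=
  [x.action.toBool] ++ (List.replicate x.n true ++ [false]) ++
  ((List.finRange x.n).flatMap fun i =>
    [decide (i ∈ x.I.A), decide (i ∈ x.I.AQ), decide (i ∈ x.S), decide (x.e = .inl i)]) ++
  ((List.finRange x.n).flatMap fun i => (List.finRange x.n).flatMap fun k =>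
    [decide ((i, k) ∈ x.I.R), decide ((i, k) ∈ x.I.RQ), decide (x.e = .inr (i, k))])

/-- The decision problem `j`-relevance as a language: the encodings of the yes-instances. The
action is part of the input. -/
def relevanceProblem (j : Status) : Language Bool :=
  {w | ∃ x : Input, x.encode = w ∧ Relevant j x.I x.S x.action x.e}

/-- The class P: the languages over `{0, 1}` whose characteristic function is computed, on every
word, by a Turing machine in a number of steps bounded by a polynomial in the length of the
word. -/
def InP (L : Language Bool) : Prop :=
  ∃ f : List Bool → Bool, (∀ w, f w = true ↔ w ∈ L) ∧
    Nonempty (Turing.TM2ComputableInPolyTime (id : List Bool → List Bool)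
      Computability.encodeBool f)

end ArgFW

/-! ### Structured stack programs -/

/-! Given a framework and a set `S`, call an argument undecided if it is neither in `S` nor attacked
by `S`, and let `W` be the set of undecided arguments. Then `S` is admissible iff it is
conflict-free and no attack runs from `W` to `S`; it is stable iff moreover `W` is empty, and
complete iff it is admissible and every member of `W` is attacked from within `W`
(`isExtension_iff`).

Relevance of `e` asks for a completion in which `S` is an extension on one side of the flip of `e`
and not on the other. A single flip can do this in few ways: it changes membership or conflicts
inside `S`; it makes an undecided argument attack `S`; it takes from an undecided argument its only
undecided attacker (complete semantics only); or it lets an argument `y`, otherwise absent or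
attacked by `S`, block `S`. This gives the criteria `AddCrit` and `RemCrit` (`relevant_true_iff`),
and status false is reduced to status true by exchanging the two actions (`relevant_false_iff`).

Each criterion asks, up to local conditions, whether a suitable `W` exists: it must avoid some
arguments, contain others, and every certain argument outside `S` and `W`, apart from an exempted
one, must possibly be attacked by `S`. From such a `W` a completion is built by leaving out unneeded
uncertain arguments and choosing the uncertain attacks in favour of `S` and `W` (`Good.lab`). The
constraints on `W` say that `W` is contained in its image under a monotone operator, and the
remaining conditions only get easier as `W` grows. Hence it suffices to test the largest such set,
reached from the set of all arguments in at most as many steps as there are names (`verif_iff`).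
This makes the search polynomial.

For the machine model, the criteria and the well-formedness of the input are expressed by formulas
over the positions of the input word: first-order quantifiers over positions, arithmetic terms, and
an operator iterating the update of a Boolean array (`Fm`). Every fixed formula is evaluated by a
structured stack program in polynomial time, by induction on the formula (`Fm.exec_prog`), and such
programs compile to stack machines step for step (`Runs.reachIn`, `computable_of_exec`). -/

namespace StackProg

open Turing

/-- Elementary operations on Boolean stacks; the register holds the last popped value. -/
inductive Op (K : Type)
  | push (k : K) (f : Option Bool → Bool)
  | pop (k : K)
  | peek (k : K)

/-- Structured programs; `loop o c p` performs `o`, and as long as the register then satisfies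
`c` performs `p` and starts again. -/
inductive Prog (K : Type)
  | op (o : Op K)
  | seq (p q : Prog K)
  | ite (c : Option Bool → Bool) (p q : Prog K)
  | loop (o : Op K) (c : Option Bool → Bool) (p : Prog K)

variable {K : Type} [DecidableEq K]

/-- The contents of the stacks. -/
abbrev Mem (K : Type) := K → List Bool

/-- The effect of an operation on register and stacks. -/
def Op.run : Op K → Option Bool × Mem K → Option Bool × Mem K
  | .push k f, (v, s) => (v, Function.update s k (f v :: s k))
  | .pop k, (_, s) => ((s k).head?, Function.update s k (s k).tail)
  | .peek k, (_, s) => ((s k).head?, s)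

/-- Big-step semantics with the number of steps. -/
inductive Runs : Prog K → Option Bool × Mem K → Option Bool × Mem K → ℕ → Prop
  | op (o a) : Runs (.op o) a (o.run a) 1
  | seq {p q a b c t u} : Runs p a b t → Runs q b c u → Runs (.seq p q) a c (t + u)
  | ite_true {c p q a b t} : c a.1 = true → Runs p a b t → Runs (.ite c p q) a b (t + 1)
  | ite_false {c p q a b t} : c a.1 = false → Runs q a b t → Runs (.ite c p q) a b (t + 1)
  | loop_exit {o c p a} : c (o.run a).1 = false → Runs (.loop o c p) a (o.run a) 1
  | loop_step {o c p a b d t u} : c (o.run a).1 = true → Runs p (o.run a) b t →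
      Runs (.loop o c p) b d u → Runs (.loop o c p) a d (t + u + 1)

/-! ### Compilation to stack machines -/

/-- The control points of a program. -/
def Prog.Lab : Prog K → Type
  | .op _ => Unit
  | .seq p q => p.Lab ⊕ q.Lab
  | .ite _ p q => Unit ⊕ (p.Lab ⊕ q.Lab)
  | .loop _ _ p => Unit ⊕ p.Lab

/-- There are finitely many control points. -/
@[reducible]
def Prog.labFintype : (p : Prog K) → Fintype p.Lab
  | .op _ => inferInstanceAs (Fintype Unit)
  | .seq p q => @instFintypeSum _ _ p.labFintype q.labFintype
  | .ite _ p q => @instFintypeSum _ _ _ (@instFintypeSum _ _ p.labFintype q.labFintype)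
  | .loop _ _ p => @instFintypeSum _ _ _ p.labFintype

/-- The first control point. -/
def Prog.entry : (p : Prog K) → p.Lab
  | .op _ => ()
  | .seq p _ => Sum.inl p.entry
  | .ite _ _ _ => Sum.inl ()
  | .loop _ _ _ => Sum.inl ()

/-- Machine statements over Boolean stacks. -/
abbrev MStmt (K Λ : Type) := TM2.Stmt (fun _ : K => Bool) Λ (Option Bool)

/-- An operation as a machine statement. -/
def Op.stmt {Λ : Type} : Op K → MStmt K Λ → MStmt K Λ
  | .push k f, q => .push k f q
  | .pop k, q => .pop k (fun _ o => o) q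
  | .peek k, q => .peek k (fun _ o => o) q

/-- The machine code of a program, with a given placement of its control points and a given
exit. -/
def Prog.code {Λ : Type} : (p : Prog K) → (p.Lab → Λ) → Λ → p.Lab → MStmt K Λ
  | .op o, _, ex, _ => o.stmt (.goto fun _ => ex)
  | .seq p q, pl, ex, l =>
      match l with
      | .inl l => p.code (fun l => pl (.inl l)) (pl (.inr q.entry)) l
      | .inr l => q.code (fun l => pl (.inr l)) ex l
  | .ite c p q, pl, ex, l =>
      match l with
      | .inl _ => .branch c (.goto fun _ => pl (.inr (.inl p.entry)))
          (.goto fun _ => pl (.inr (.inr q.entry)))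
      | .inr (.inl l) => p.code (fun l => pl (.inr (.inl l))) ex l
      | .inr (.inr l) => q.code (fun l => pl (.inr (.inr l))) ex l
  | .loop o c p, pl, ex, l =>
      match l with
      | .inl _ => o.stmt (.branch c (.goto fun _ => pl (.inr p.entry)) (.goto fun _ => ex))
      | .inr l => p.code (fun l => pl (.inr l)) (pl (.inl ())) l

/-- `b` is reached from `a` in `t` machine steps. -/
def ReachIn {Λ : Type} (M : Λ → MStmt K Λ) (a b : TM2.Cfg (fun _ : K => Bool) Λ (Option Bool))
    (t : ℕ) : Prop :=
  (flip bind (TM2.step M))^[t] (some a) = some b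

theorem ReachIn.trans {Λ : Type} {M : Λ → MStmt K Λ}
    {a b c : TM2.Cfg (fun _ : K => Bool) Λ (Option Bool)} {t u : ℕ}
    (h : ReachIn M a b t) (h' : ReachIn M b c u) : ReachIn M a c (t + u) := by
  unfold ReachIn at *
  rw [Nat.add_comm, Function.iterate_add_apply, h, h']

theorem ReachIn.one {Λ : Type} {M : Λ → MStmt K Λ}
    {b : TM2.Cfg (fun _ : K => Bool) Λ (Option Bool)} {l : Λ} {v : Option Bool} {s : Mem K}
    (h : TM2.stepAux (M l) v s = b) : ReachIn M ⟨some l, v, s⟩ b 1 := by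
  subst h; rfl

theorem Op.stepAux_stmt {Λ : Type} (o : Op K) (q : MStmt K Λ) (v : Option Bool) (s : Mem K) :
    TM2.stepAux (o.stmt q) v s = TM2.stepAux q (o.run (v, s)).1 (o.run (v, s)).2 := by
  cases o <;> rfl

/-- Compiled code performs every run of the program. -/
theorem Runs.reachIn {p : Prog K} {a b : Option Bool × Mem K} {t : ℕ} (h : Runs p a b t)
    {Λ : Type} {M : Λ → MStmt K Λ} (pl : p.Lab → Λ) (ex : Λ)
    (hM : ∀ l, M (pl l) = p.code pl ex l) :
    ReachIn M ⟨some (pl p.entry), a.1, a.2⟩ ⟨some ex, b.1, b.2⟩ t := by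
  induction h generalizing ex with
  | op o a =>
    refine ReachIn.one ?_
    rw [hM]; simp [Prog.code, Op.stepAux_stmt]
  | seq _ _ ih₁ ih₂ =>
    exact (ih₁ (fun l => pl (.inl l)) _ fun l => hM _).trans
      (ih₂ (fun l => pl (.inr l)) _ fun l => hM _)
  | ite_true hc _ ih =>
    rw [Nat.add_comm]
    refine (ReachIn.one ?_).trans (ih (fun l => pl (.inr (.inl l))) _ fun l => hM _)
    rw [hM]; simp [Prog.code, Prog.entry, hc]
  | ite_false hc _ ih =>
    rw [Nat.add_comm]
    refine (ReachIn.one ?_).trans (ih (fun l => pl (.inr (.inr l))) _ fun l => hM _)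
    rw [hM]; simp [Prog.code, Prog.entry, hc]
  | loop_exit hc =>
    refine ReachIn.one ?_
    rw [hM]; simp [Prog.code, Prog.entry, Op.stepAux_stmt, hc]
  | loop_step hc _ _ ih₁ ih₂ =>
    rw [Nat.add_comm]
    refine (ReachIn.one ?_).trans
      ((ih₁ (fun l => pl (.inr l)) (pl (.inl ())) fun l => hM _).trans (ih₂ pl ex hM))
    rw [hM]; simp [Prog.code, Prog.entry, Op.stepAux_stmt, hc]

/-- The machine running a program, with the input on stack `k₀` and the output on stack `k₁`. -/
def Prog.machine [Fintype K] (p : Prog K) (k₀ k₁ : K) : FinTM2 :=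
  letI := p.labFintype
  { k₀ := k₀
    k₁ := k₁
    Γ := fun _ => Bool
    Λ := Option p.Lab
    main := some p.entry
    σ := Option Bool
    initialState := none
    m := fun l =>
      match l with
      -- A halting configuration must have the initial value in the register, so a last step resets
      -- it. This is the `+ 1` in the time bound.
      | none => .load (fun _ => none) .halt
      | some l => p.code some none l }

/-- `p` turns memory `s` into `s'` in at most `t` steps, whatever the register holds. -/
def Exec (p : Prog K) (s s' : Mem K) (t : ℕ) : Prop :=
  ∀ v, ∃ v', ∃ u ≤ t, Runs p (v, s) (v', s') u

/-- The memory with `l` on stack `k` and all other stacks empty. -/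
def single (k : K) (l : List Bool) : Mem K := Function.update (fun _ => []) k l

/-- A program deciding `f` in polynomial time yields a polynomial time machine. -/
theorem computable_of_exec [Fintype K] (p : Prog K) (k₀ k₁ : K) (f : List Bool → Bool)
    (P : Polynomial ℕ)
    (h : ∀ w, Exec p (single k₀ w) (single k₁ [f w]) (P.eval w.length)) :
    Nonempty (TM2ComputableInPolyTime (id : List Bool → List Bool) Computability.encodeBool f) := by
  refine ⟨{
    tm := p.machine k₀ k₁
    inputAlphabet := Equiv.refl Bool
    outputAlphabet := Equiv.refl Bool
    time := P + 1
    outputsFun := fun w => Classical.choice ?_ }⟩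
  obtain ⟨v', u, hu, hr⟩ := h w none
  have h₁ := hr.reachIn (M := (p.machine k₀ k₁).m) some none fun l => rfl
  have h₂ : ReachIn (p.machine k₀ k₁).m ⟨some none, v', single k₁ [f w]⟩
    ⟨none, none, single k₁ [f w]⟩ 1 := ReachIn.one rfl
  have h₃ : initList (p.machine k₀ k₁) w =
      (⟨some (some p.entry), none, single k₀ w⟩ : TM2.Cfg _ (Option p.Lab) _) := by
    simp only [initList]
    congr 1
    funext k
    change K at k
    by_cases hk : k = k₀
    · refine (dif_pos hk).trans ?_
      have h₀ : single k₀ w k = w := by rw [hk, single, Function.update_self]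
      exact h₀.symm
    · refine (dif_neg hk).trans ?_
      rw [single, Function.update_of_ne hk]; rfl
  have h₄ : haltList (p.machine k₀ k₁) [f w] =
      (⟨none, none, single k₁ [f w]⟩ : TM2.Cfg _ (Option p.Lab) _) := by
    simp only [haltList]
    congr 1
    funext k
    change K at k
    by_cases hk : k = k₁
    · refine (dif_pos hk).trans ?_
      have h₀ : single k₁ [f w] k = [f w] := by rw [hk, single, Function.update_self]
      exact h₀.symm
    · refine (dif_neg hk).trans ?_
      rw [single, Function.update_of_ne hk]; rfl
  refine ⟨⟨⟨u + 1, ?_⟩, by simpa using hu⟩⟩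
  have h₅ := h₁.trans h₂
  have h₆ : (flip bind (p.machine k₀ k₁).step)^[u + 1] (some (initList (p.machine k₀ k₁) w)) =
      some (haltList (p.machine k₀ k₁) [f w]) := by
    rw [h₃, h₄]
    exact h₅
  -- In the goal the words are mapped along the identity alphabet equivalences; they are generalized
  -- to lists merely equal to `w` and `[f w]`.
  have h₇ : ∀ l l', l = w → l' = [f w] →
      (flip bind (p.machine k₀ k₁).step)^[u + 1] (some (initList (p.machine k₀ k₁) l)) =
        some (haltList (p.machine k₀ k₁) l') := by
    intro l l' hl hl'
    rw [hl, hl']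
    exact h₆
  exact h₇ _ _ (List.map_id w) rfl

end StackProg

/-! ### Time bounds for stack programs, and basic routines -/

namespace StackProg

open Turing

section Exec

variable {K : Type} [DecidableEq K]

/-- `p`, started with `v` in the register, turns memory `s` into `s'` in at most `t` steps. -/
def ExecAt (p : Prog K) (v : Option Bool) (s s' : Mem K) (t : ℕ) : Prop :=
  ∃ v', ∃ u ≤ t, Runs p (v, s) (v', s') u

theorem Exec.mono {p : Prog K} {s s' : Mem K} {t u : ℕ} (h : Exec p s s' t) (htu : t ≤ u) :
    Exec p s s' u := fun v =>
  let ⟨v', n, hn, hr⟩ := h v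
  ⟨v', n, hn.trans htu, hr⟩

theorem Exec.of_eq {p : Prog K} {s s' r r' : Mem K} {t u : ℕ} (h : Exec p s s' t) (hr : s = r)
    (hr' : s' = r') (htu : t ≤ u) : Exec p r r' u := by
  subst hr hr'; exact h.mono htu

theorem Exec.seq {p q : Prog K} {a b c : Mem K} {t u : ℕ} (h : Exec p a b t) (h' : Exec q b c u) :
    Exec (.seq p q) a c (t + u) := fun v =>
  let ⟨v', n, hn, hr⟩ := h v
  let ⟨v'', m, hm, hr'⟩ := h' v'
  ⟨v'', n + m, Nat.add_le_add hn hm, hr.seq hr'⟩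

theorem Exec.op {o : Op K} {s s' : Mem K} (h : ∀ v, (o.run (v, s)).2 = s') : Exec (.op o) s s' 1 :=
  fun v => ⟨_, 1, le_rfl, by rw [← h v]; exact Runs.op o (v, s)⟩

theorem ExecAt.op {o : Op K} {v : Option Bool} {s s' : Mem K} (h : (o.run (v, s)).2 = s') :
    ExecAt (.op o) v s s' 1 :=
  ⟨_, 1, le_rfl, by rw [← h]; exact Runs.op o (v, s)⟩

theorem ExecAt.seq {p q : Prog K} {v : Option Bool} {a b c : Mem K} {t u : ℕ}
    (h : ExecAt p v a b t) (h' : Exec q b c u) : ExecAt (.seq p q) v a c (t + u) :=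
  let ⟨v', n, hn, hr⟩ := h
  let ⟨v'', m, hm, hr'⟩ := h' v'
  ⟨v'', n + m, Nat.add_le_add hn hm, hr.seq hr'⟩

/-- An operation whose effect does not depend on the register, followed by a program that may
use the new register. -/
theorem Exec.op_seq {o : Op K} {q : Prog K} {s s₁ s' : Mem K} {x : Option Bool} {t : ℕ}
    (h : ∀ v, o.run (v, s) = (x, s₁)) (h' : ExecAt q x s₁ s' t) :
    Exec (.seq (.op o) q) s s' (t + 1) := fun v => by
  obtain ⟨v', n, hn, hr⟩ := h'
  refine ⟨v', 1 + n, by omega, ?_⟩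
  refine Runs.seq (Runs.op o (v, s)) ?_
  rw [h v]; exact hr

theorem ExecAt.ite {c : Option Bool → Bool} {p q : Prog K} {v : Option Bool} {s s' : Mem K} {t : ℕ}
    (h : ExecAt (if c v then p else q) v s s' t) : ExecAt (.ite c p q) v s s' (t + 1) := by
  obtain ⟨v', n, hn, hr⟩ := h
  refine ⟨v', n + 1, by omega, ?_⟩
  cases hc : c v
  · rw [hc] at hr; exact Runs.ite_false hc hr
  · rw [hc] at hr; exact Runs.ite_true hc hr

/-- A loop with a family of intermediate states. -/
theorem Exec.loop {o : Op K} {c : Option Bool → Bool} {p : Prog K} (g : Mem K → Option Bool)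
    (f : Mem K → Mem K) (ho : ∀ v s, o.run (v, s) = (g s, f s)) (st : ℕ → Mem K) (m t : ℕ)
    (h : ∀ i < m, c (g (st i)) = true ∧ ExecAt p (g (st i)) (f (st i)) (st (i + 1)) t)
    (hm : c (g (st m)) = false) : Exec (.loop o c p) (st 0) (f (st m)) (m * (t + 1) + 1) := by
  induction m generalizing st with
  | zero =>
    intro v
    refine ⟨g (st 0), 1, by omega, ?_⟩
    have := Runs.loop_exit (o := o) (c := c) (p := p) (a := (v, st 0))
    rw [ho] at this
    exact this hm
  | succ m ih =>
    intro v
    obtain ⟨hc, v₁, n, hn, hr⟩ := h 0 (by omega)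
    obtain ⟨v₂, n', hn', hr'⟩ := ih (fun i => st (i + 1)) (fun i hi => h (i + 1) (by omega)) hm v₁
    refine ⟨v₂, n + n' + 1, ?_, ?_⟩
    · rw [Nat.add_mul]; omega
    · have := Runs.loop_step (o := o) (c := c) (p := p) (a := (v, st 0)) (b := (v₁, st 1))
        (d := (v₂, f (st (m + 1)))) (t := n) (u := n')
      rw [ho] at this
      exact this hc hr hr'

/-- Push the bit `b`. -/
def push (k : K) (b : Bool) : Prog K := .op (.push k fun _ => b)

theorem exec_push (k : K) (b : Bool) (s : Mem K) :
    Exec (push k b) s (Function.update s k (b :: s k)) 1 := Exec.op fun _ => rfl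

/-- Pop and forget. -/
def drop (k : K) : Prog K := .op (.pop k)

theorem exec_drop (k : K) (s : Mem K) :
    Exec (drop k) s (Function.update s k (s k).tail) 1 := Exec.op fun _ => rfl

/-- Pop a leading `true`, and go on as long as there is one. -/
def whileTrue (k : K) (p : Prog K) : Prog K :=
  .loop (.peek k) (fun v => v == some true) (.seq (drop k) p)

theorem exec_whileTrue {k : K} {p : Prog K} (st : ℕ → Mem K) (m t : ℕ)
    (h : ∀ i < m, ((st i) k).head? = some true ∧
      Exec p (Function.update (st i) k ((st i) k).tail) (st (i + 1)) t)
    (hm : ((st m) k).head? ≠ some true) : Exec (whileTrue k p) (st 0) (st m) (m * (t + 2) + 1) := by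
  refine (Exec.loop (fun s => (s k).head?) (fun s => s) (fun _ _ => rfl) st m (1 + t) ?_ ?_).mono ?_
  · intro i hi
    exact ⟨by simp [(h i hi).1], ((exec_drop k (st i)).seq (h i hi).2) _⟩
  · simpa using hm
  · rw [show 1 + t + 1 = t + 2 by omega]

/-- Push `true` on each of the stacks `ks`. -/
def ticks : List K → K → Prog K
  -- Peeking changes only the register, so it serves as the empty program.
  | [], a => .op (.peek a)
  | k :: ks, a => .seq (push k true) (ticks ks a)

/-- Move the leading `true`s of `a` to each of the stacks `ks`. -/
def transfer (a : K) (ks : List K) : Prog K := whileTrue a (ticks ks a)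

theorem exec_ticks (ks : List K) (hks : ks.Nodup) (a : K) (s : Mem K) :
    Exec (ticks ks a) s (fun k => if k ∈ ks then true :: s k else s k) (ks.length + 1) := by
  induction ks generalizing s with
  | nil => exact Exec.op fun _ => by simp [Op.run]
  | cons k ks ih =>
    rw [List.nodup_cons] at hks
    have h := (exec_push k true s).seq (ih hks.2 _)
    refine h.of_eq rfl ?_ (by simp; omega)
    funext j
    by_cases hj : j = k
    · subst hj; simp [hks.1]
    · simp [hj]

/-- Several targets copy a unary number, and an empty list of targets erases it; the arithmetic
below uses both. The condition on `r` makes the loop stop exactly at the end of the number. -/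
theorem exec_transfer {a : K} {ks : List K} (hks : ks.Nodup) (ha : a ∉ ks) (s : Mem K) (m : ℕ)
    (r : List Bool) (hs : s a = List.replicate m true ++ r) (hr : r.head? ≠ some true) :
    Exec (transfer a ks) s
      (fun k => if k = a then r else if k ∈ ks then List.replicate m true ++ s k else s k)
      (m * (ks.length + 3) + 1) := by
  have h := exec_whileTrue (k := a) (p := ticks ks a)
    (fun i k => if k = a then List.replicate (m - i) true ++ r
      else if k ∈ ks then List.replicate i true ++ s k else s k) m (ks.length + 1) ?_ ?_
  · refine h.of_eq ?_ ?_ le_rfl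
    · funext k
      by_cases hk : k = a
      · subst hk; simp [hs]
      · simp [hk]
    · funext k
      simp
  · intro i hi
    obtain ⟨j, hj⟩ : ∃ j, m - i = j + 1 := ⟨m - i - 1, by omega⟩
    refine ⟨by simp [hj, List.replicate_succ], ?_⟩
    convert exec_ticks ks hks a _ using 1
    funext k
    by_cases hk : k = a
    · subst hk; simp [ha, hj, List.replicate_succ, show m - (i + 1) = j by omega]
    · by_cases hk' : k ∈ ks <;> simp [hk, hk', List.replicate_succ]
  · simpa using hr

/-- Move everything from `a` to `b`, in reverse order. -/
def pour (a b : K) : Prog K :=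
  .loop (.pop a) Option.isSome (.op (.push b fun v => v.getD false))

theorem exec_pour {a b : K} (hab : a ≠ b) (s : Mem K) :
    Exec (pour a b) s
      (fun k => if k = a then [] else if k = b then (s a).reverse ++ s b else s k)
      ((s a).length * 2 + 1) := by
  have h := Exec.loop (o := .pop a) (c := Option.isSome) (p := .op (.push b fun v => v.getD false))
    (fun s => (s a).head?) (fun s => Function.update s a (s a).tail) (fun _ _ => rfl)
    (fun i k => if k = a then (s a).drop i
      else if k = b then ((s a).take i).reverse ++ s b else s k) (s a).length 1 ?_ ?_
  · refine h.of_eq ?_ ?_ le_rfl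
    · funext k
      by_cases hk : k = a
      · subst hk; simp
      · by_cases hk' : k = b
        · subst hk'; simp [hk]
        · simp [hk, hk']
    · funext k
      by_cases hk : k = a
      · subst hk; simp
      · simp [hk]
  · intro i hi
    refine ⟨by simp [hi], ExecAt.op ?_⟩
    funext k
    have hba := hab.symm
    by_cases hk : k = a
    · subst hk; simp [Op.run, hab]
    · by_cases hk' : k = b
      · subst hk'
        have ht : ((s a).take (i + 1)).reverse = (s a)[i] :: ((s a).take i).reverse := by
          rw [List.take_succ_eq_append_getElem hi, List.reverse_append]; rfl
        simp [Op.run, hk, ht, hi]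
      · simp [Op.run, hk, hk']
  · simp

/-- Move one bit from `a` to `b`, if there is one. -/
def shift (a b : K) : Prog K :=
  .seq (.op (.pop a)) (.ite Option.isSome (.op (.push b fun v => v.getD false)) (.op (.peek a)))

theorem exec_shift {a b : K} (hab : a ≠ b) (s : Mem K) :
    Exec (shift a b) s
      (fun k => if k = a then (s a).tail else if k = b then (s a).head?.toList ++ s b else s k)
      3 := by
  refine Exec.op_seq (fun _ => rfl) (ExecAt.ite ?_)
  have hba := hab.symm
  rcases hs : s a with _ | ⟨x, l⟩
  · refine ExecAt.op ?_
    funext k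
    by_cases hk : k = a
    · subst hk; simp [Op.run]
    · by_cases hk' : k = b
      · subst hk'; simp [Op.run, hk]
      · simp [Op.run, hk, hk']
  · refine ExecAt.op ?_
    funext k
    by_cases hk : k = a
    · subst hk; simp [Op.run, hab]
    · by_cases hk' : k = b
      · subst hk'; simp [Op.run, hk]
      · simp [Op.run, hk, hk']

/-- Push the value of a test of the top of `a` on `b`. -/
def test (a b : K) (c : Option Bool → Bool) : Prog K := .seq (.op (.peek a)) (.op (.push b c))

theorem exec_test (a b : K) (c : Option Bool → Bool) (s : Mem K) :
    Exec (test a b c) s (Function.update s b (c (s a).head? :: s b)) 2 :=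
  Exec.op_seq (fun _ => rfl) (ExecAt.op rfl)

/-- Replace the two top bits of `a` by a combination of them. -/
def combine (a : K) (f : Bool → Bool → Bool) : Prog K :=
  .seq (.op (.pop a)) (.ite (fun v => v == some true)
    (.seq (.op (.pop a)) (.op (.push a fun v => f (v.getD false) true)))
    (.seq (.op (.pop a)) (.op (.push a fun v => f (v.getD false) false))))

theorem exec_combine (a : K) (f : Bool → Bool → Bool) (s : Mem K) (x y : Bool) (l : List Bool)
    (hs : s a = y :: x :: l) : Exec (combine a f) s (Function.update s a (f x y :: l)) 4 := by
  refine Exec.op_seq (fun _ => rfl) (ExecAt.ite ?_)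
  rw [hs]
  cases y
  · refine Exec.op_seq (t := 1) (fun _ => rfl) (ExecAt.op ?_) _
    simp [Op.run]
  · refine Exec.op_seq (t := 1) (fun _ => rfl) (ExecAt.op ?_) _
    simp [Op.run]

end Exec

end StackProg

/-! ### Memory layout, counted loops and unary arithmetic -/

namespace StackProg

open Turing

/-- The stacks used for evaluating formulas: the input, three scratch stacks, loop counters,
values of terms, truth values, the array, and one stack for each variable. -/
inductive Stk (ι : Type)
  | inp | t1 | t2 | t3 | cnt | term | val | arr
  | var (i : ι)
  deriving DecidableEq, Fintype

variable {ι : Type} [DecidableEq ι]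

open Stk

/-- Push `true` on `k` once for each bit of the input. -/
def countIn (k : Stk ι) : Prog (Stk ι) :=
  .seq (.loop (.pop inp) Option.isSome
    (.seq (.op (.push t1 fun v => v.getD false)) (push k true))) (pour t1 inp)

/-- The input can be read only by popping it. It is therefore parked in reverse on `t1` and poured
back, which restores the order. -/
theorem exec_countIn {k : Stk ι} (hi : k ≠ inp) (ht : k ≠ t1) (s : Mem (Stk ι))
    (hs : s t1 = []) :
    Exec (countIn k) s
      (Function.update s k (List.replicate (s inp).length true ++ s k))
      ((s inp).length * 5 + 2) := by
  have h := Exec.loop (o := .pop inp) (c := Option.isSome)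
    (p := .seq (.op (.push t1 fun v => v.getD false)) (push k true))
    (fun s => (s inp).head?) (fun s => Function.update s inp (s inp).tail) (fun _ _ => rfl)
    (fun i j => if j = inp then (s inp).drop i
      else if j = t1 then ((s inp).take i).reverse
      else if j = k then List.replicate i true ++ s k else s j) (s inp).length 2 ?_ ?_
  · refine (h.seq (exec_pour (a := t1) (b := inp) (by simp) _)).of_eq ?_ ?_ ?_
    · funext j
      by_cases hj : j = inp
      · subst hj; simp
      by_cases hj' : j = t1
      · subst hj'; simp [hs]
      by_cases hk : j = k
      · subst hk; simp [hj, hj']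
      simp [hj, hj', hk]
    · funext j
      by_cases hj : j = inp
      · subst hj; simp [hi.symm]
      by_cases hj' : j = t1
      · subst hj'; simp [hs, ht.symm]
      by_cases hk : j = k
      · subst hk; simp [hj, hj']
      simp [hj, hj', hk]
    · simp; omega
  · intro i hi'
    refine ⟨by simp [hi'], (ExecAt.op rfl).seq ((exec_push k true _).of_eq rfl ?_ le_rfl)⟩
    have ht' : ((s inp).take (i + 1)).reverse = (s inp)[i] :: ((s inp).take i).reverse := by
      rw [List.take_succ_eq_append_getElem hi', List.reverse_append]; rfl
    funext j
    by_cases hj : j = inp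
    · subst hj; simp [hi.symm, Op.run]
    by_cases hj' : j = t1
    · subst hj'; simp [ht.symm, Op.run, ht', hi']
    by_cases hk : j = k
    · subst hk; simp [hj, hj', Op.run, List.replicate_succ]
    simp [hj, hj', hk, Op.run]
  · simp

/-- Perform `p` once for each bit of the input. -/
def loopN (p : Prog (Stk ι)) : Prog (Stk ι) :=
  .seq (push cnt false) (.seq (countIn cnt) (.seq (whileTrue cnt p) (drop cnt)))

/-- The counter of a loop lies on `cnt` above a `false`, so nested loops share this one stack. The
body has to work above an arbitrary content `D` of `cnt`, while `st` describes the memory as seen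
without the counter of this loop. -/
theorem exec_loopN {p : Prog (Stk ι)} (st : ℕ → Mem (Stk ι)) (N t : ℕ) (C : List Bool)
    (hN : (st 0 inp).length = N) (h1 : st 0 t1 = []) (hC : ∀ i ≤ N, st i cnt = C)
    (h : ∀ i < N, ∀ D, Exec p (Function.update (st i) cnt D) (Function.update (st (i + 1)) cnt D) t) :
    Exec (loopN p) (st 0) (st N) (N * (t + 7) + 5) := by
  have h₁ := exec_countIn (k := cnt) (by simp) (by simp)
    (Function.update (st 0) cnt (false :: st 0 cnt)) (by simpa using h1)
  have h₂ := exec_whileTrue (k := cnt) (p := p)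
    (fun i => Function.update (st i) cnt (List.replicate (N - i) true ++ false :: C)) N t ?_ ?_
  · refine ((exec_push _ _ _).seq (h₁.seq ((h₂.of_eq ?_ rfl le_rfl).seq
      (exec_drop _ _)))).of_eq rfl ?_ ?_
    · simp [hN, hC]
    · funext j
      by_cases hj : j = cnt
      · subst hj; simp [hC]
      · simp [hj]
    · simp only [ne_eq, reduceCtorEq, not_false_eq_true, Function.update_of_ne, hN]
      ring_nf; omega
  · intro i hi
    obtain ⟨j, hj⟩ : ∃ j, N - i = j + 1 := ⟨N - i - 1, by omega⟩
    refine ⟨by simp [hj, List.replicate_succ], ?_⟩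
    refine (h i hi (List.replicate j true ++ false :: C)).of_eq ?_ ?_ le_rfl
    · simp [hj, List.replicate_succ]
    · rw [show N - (i + 1) = j by omega]
  · simp

/-- The value of the number variable kept on a stack: the number of leading `true`s. -/
def ones (l : List Bool) : ℕ := (l.takeWhile id).length

theorem exists_ones (l : List Bool) :
    ∃ r, l = List.replicate (ones l) true ++ r ∧ r.head? ≠ some true := by
  induction l with
  | nil => exact ⟨[], by simp [ones]⟩
  | cons b l ih =>
    obtain ⟨r, hr, hr'⟩ := ih
    cases b
    · exact ⟨false :: l, by simp [ones]⟩
    · refine ⟨r, ?_, hr'⟩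
      have : ones (true :: l) = ones l + 1 := by simp [ones]
      rw [this, List.replicate_succ, List.cons_append, ← hr]

theorem ones_replicate (n : ℕ) (l : List Bool) :
    ones (List.replicate n true ++ false :: l) = n := by
  induction n with
  | zero => simp [ones]
  | succ n _ => simp [ones, List.replicate_succ]

/-- The memory is in order for evaluating terms and formulas on input `w` with values `env` of
the variables. -/
structure Ready (w : List Bool) (env : ι → ℕ) (s : Mem (Stk ι)) : Prop where
  inp : s inp = w
  t1 : s t1 = []
  t2 : s t2 = []
  t3 : s t3 = []
  var : ∀ i, ones (s (.var i)) = env i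
  le : ∀ i, env i ≤ w.length

/-! ### Terms -/

/-- Terms for natural numbers; `len` is the length of the input. -/
inductive Tm (ι : Type)
  | var (i : ι)
  | lit (c : ℕ)
  | len
  | add (a b : Tm ι)
  | mul (a b : Tm ι)

/-- The value of a term. -/
def Tm.eval (w : List Bool) (env : ι → ℕ) : Tm ι → ℕ
  | .var i => env i
  | .lit c => c
  | .len => w.length
  | .add a b => a.eval w env + b.eval w env
  | .mul a b => a.eval w env * b.eval w env

/-- Multiply the two numbers on top of the stack of term values. -/
def mulTop : Prog (Stk ι) :=
  .seq (transfer term [t1]) (.seq (drop term) (.seq (transfer term [t2])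
    (.seq (whileTrue t2 (.seq (transfer t1 [t3, term]) (transfer t3 [t1]))) (transfer t1 []))))

/-- Push a constant on the stack of term values. -/
def litProg : ℕ → Prog (Stk ι)
  | 0 => push term false
  | c + 1 => .seq (litProg c) (push term true)

/-- Push the value of a term in unary, above a `false`, on the stack of term values. -/
def Tm.prog : Tm ι → Prog (Stk ι)
  | .var i => .seq (push term false) (.seq (transfer (.var i) [t1]) (transfer t1 [.var i, term]))
  | .lit c => litProg c
  | .len => .seq (push term false) (countIn term)
  | .add a b => .seq a.prog (.seq b.prog
      (.seq (transfer term [t1]) (.seq (drop term) (transfer t1 [term]))))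
  | .mul a b => .seq a.prog (.seq b.prog mulTop)

theorem replicate_append_append (a b : ℕ) (l : List Bool) :
    List.replicate b true ++ (List.replicate a true ++ l) = List.replicate (a + b) true ++ l := by
  rw [← List.append_assoc, List.replicate_append_replicate, Nat.add_comm]

/-- The memory with the number `n` pushed on the stack of term values. -/
def pushNum (s : Mem (Stk ι)) (n : ℕ) : Mem (Stk ι) :=
  Function.update s term (List.replicate n true ++ false :: s term)

theorem Ready.pushNum {w : List Bool} {env : ι → ℕ} {s : Mem (Stk ι)} (h : Ready w env s) (n : ℕ) :
    Ready w env (pushNum s n) := by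
  constructor <;> simp [StackProg.pushNum, h.inp, h.t1, h.t2, h.t3, h.var, h.le]

theorem exec_addTop {w : List Bool} {env : ι → ℕ} {s : Mem (Stk ι)} (h : Ready w env s) (a b : ℕ) :
    Exec (.seq (transfer term [t1]) (.seq (drop term) (transfer t1 [term])))
      (pushNum (pushNum s a) b) (pushNum s (a + b)) (b * 8 + 3) := by
  have e₁ := exec_transfer (a := (term : Stk ι)) (ks := [t1]) (by simp) (by simp)
    (pushNum (pushNum s a) b) b (false :: List.replicate a true ++ false :: s term)
    (by simp [pushNum]) (by simp)
  refine (e₁.seq ((exec_drop _ _).seq (exec_transfer (a := (t1 : Stk ι)) (ks := [term]) (by simp)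
    (by simp) _ b [] ?_ ?_))).of_eq rfl ?_ ?_
  · simp [pushNum, h.t1]
  · simp
  · funext k
    cases k <;> simp [pushNum, h.t1, replicate_append_append]
  · simp; omega

/-- Multiplication is repeated addition: for each of the `a` marks on `t2`, the number `b` on `t1`
is copied to the result, with `t3` as the second copy from which `t1` is restored. -/
theorem exec_mulTop {w : List Bool} {env : ι → ℕ} {s : Mem (Stk ι)} (h : Ready w env s) (a b : ℕ) :
    Exec mulTop (pushNum (pushNum s a) b) (pushNum s (a * b))
      (b * 4 + 1 + 1 + (a * 4 + 1) + (a * (b * 9 + 4) + 1) + (b * 3 + 1)) := by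
  have e₁ := exec_transfer (a := (term : Stk ι)) (ks := [t1]) (by simp) (by simp)
    (pushNum (pushNum s a) b) b (false :: List.replicate a true ++ false :: s term)
    (by simp [pushNum]) (by simp)
  -- The memory after `i` rounds. The `false` that closed the factor `a` on `term` now closes the
  -- product.
  let st : ℕ → Mem (Stk ι) := fun i k => match k with
    | t1 => List.replicate b true
    | t2 => List.replicate (a - i) true
    | term => List.replicate (i * b) true ++ false :: s term
    | k => s k
  have e₂ := exec_whileTrue (k := (t2 : Stk ι))
    (p := .seq (transfer t1 [t3, term]) (transfer t3 [t1])) st a (b * 9 + 2) ?_ ?_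
  · refine (e₁.seq ((exec_drop _ _).seq ((exec_transfer (a := (term : Stk ι)) (ks := [t2]) (by simp)
      (by simp) _ a (false :: s term) ?_ ?_).seq ((e₂.of_eq ?_ rfl le_rfl).seq
      (exec_transfer (a := (t1 : Stk ι)) (ks := []) (by simp) (by simp) _ b [] ?_ ?_))))).of_eq
      rfl ?_ ?_
    · simp
    · simp
    · funext k
      cases k <;> simp [pushNum, h.t1, h.t2, st]
    · simp [st]
    · simp
    · funext k
      cases k <;> simp [pushNum, h.t1, h.t2, st]
    · have : b * 9 + 2 + 2 = b * 9 + 4 := rfl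
      simp [this]; omega
  · intro i hi
    obtain ⟨j, hj⟩ : ∃ j, a - i = j + 1 := ⟨a - i - 1, by omega⟩
    refine ⟨by simp [st, hj, List.replicate_succ], ?_⟩
    refine ((exec_transfer (a := (t1 : Stk ι)) (ks := [t3, term]) (by simp) (by simp) _ b [] ?_
      ?_).seq (exec_transfer (a := (t3 : Stk ι)) (ks := [t1]) (by simp) (by simp) _ b [] ?_
      ?_)).of_eq rfl ?_ ?_
    · simp [st]
    · simp
    · simp [st, h.t3]
    · simp
    · funext k
      have hj' : a - (i + 1) = j := by omega
      cases k <;> simp [st, h.t3, hj, hj', add_mul, replicate_append_append]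
    · simp; omega
  · simp [st]

/-- Values are unary, so the time for arithmetic, comparison and lookup depends on their size. The
induction therefore carries a polynomial bound `Q` on the value beside the bound `P` on the time. -/
theorem Tm.exec_prog (a : Tm ι) : ∃ P Q : Polynomial ℕ, ∀ w env s, Ready w env s →
    a.eval w env ≤ Q.eval w.length ∧
    Exec a.prog s (pushNum s (a.eval w env)) (P.eval w.length) := by
  induction a with
  | var i =>
    refine ⟨9 * .X + 3, .X, fun w env s h => ⟨by simpa [Tm.eval] using h.le i, ?_⟩⟩
    obtain ⟨r, hr, hr'⟩ := exists_ones (s (.var i))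
    rw [h.var] at hr
    have hle := h.le i
    refine ((exec_push _ _ _).seq ((exec_transfer (a := .var i) (ks := [t1]) (by simp) (by simp) _
      (env i) r ?_ hr').seq (exec_transfer (a := (t1 : Stk ι)) (ks := [.var i, term]) (by simp)
      (by simp) _ (env i) [] ?_ ?_))).of_eq rfl ?_ ?_
    · simpa using hr
    · simp [h.t1]
    · simp
    · funext k
      cases k with
      | var j =>
        by_cases hj : j = i
        · subst hj; simp [pushNum, hr]
        · simp [pushNum, hj]
      | _ => simp [pushNum, h.t1, Tm.eval]
    · simp; omega
  | lit c =>
    refine ⟨.C (c + 1), .C c, fun w env s h => ⟨by simp [Tm.eval], ?_⟩⟩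
    have h : Exec (litProg c) s (pushNum s c) (c + 1) := by
      induction c with
      | zero => exact exec_push _ _ _
      | succ c ih =>
        refine (ih.seq (exec_push _ _ _)).of_eq rfl ?_ le_rfl
        simp [pushNum, List.replicate_succ]
    exact h.of_eq rfl rfl (by simp)
  | len =>
    refine ⟨5 * .X + 3, .X, fun w env s h => ⟨by simp [Tm.eval], ?_⟩⟩
    refine ((exec_push _ _ _).seq (exec_countIn (k := term) (by simp) (by simp) _ ?_)).of_eq rfl ?_ ?_
    · simpa using h.t1
    · simp [pushNum, Tm.eval, h.inp]
    · simp [h.inp]; omega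
  | add a b iha ihb =>
    obtain ⟨P, Q, ha⟩ := iha
    obtain ⟨P', Q', hb⟩ := ihb
    refine ⟨P + P' + 8 * Q' + 3, Q + Q', fun w env s h => ?_⟩
    obtain ⟨h₁, h₂⟩ := ha w env s h
    obtain ⟨h₃, h₄⟩ := hb w env _ (h.pushNum (a.eval w env))
    refine ⟨by simp [Tm.eval]; omega, ?_⟩
    refine (h₂.seq (h₄.seq (exec_addTop h _ _))).of_eq rfl rfl ?_
    simp; omega
  | mul a b iha ihb =>
    obtain ⟨P, Q, ha⟩ := iha
    obtain ⟨P', Q', hb⟩ := ihb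
    refine ⟨P + P' + (Q' * 4 + 1 + 1 + (Q * 4 + 1) + (Q * (Q' * 9 + 4) + 1) + (Q' * 3 + 1)),
      Q * Q', fun w env s h => ?_⟩
    obtain ⟨h₁, h₂⟩ := ha w env s h
    obtain ⟨h₃, h₄⟩ := hb w env _ (h.pushNum (a.eval w env))
    refine ⟨by simpa [Tm.eval] using Nat.mul_le_mul h₁ h₃, ?_⟩
    refine (h₂.seq (h₄.seq (exec_mulTop h _ _))).of_eq rfl rfl ?_
    simp only [Polynomial.eval_add, Polynomial.eval_mul, Polynomial.eval_ofNat,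
      Polynomial.eval_one]
    have hm : a.eval w env * (b.eval w env * 9 + 4) ≤
        Q.eval w.length * (Q'.eval w.length * 9 + 4) := by gcongr
    linarith

end StackProg

namespace StackProg

open Turing

variable {ι : Type} [DecidableEq ι]

open Stk

/-! ### Formulas -/

/-- Formulas about a word and a Boolean array. `ex i φ` says that `φ` holds for some value of `i`
below the length of the word; `iter i φ ψ` is the truth value of `ψ` after the array, initially
all true, has been replaced, once for each position of the word, by the array of the truth values
of `φ`. -/
inductive Fm (ι : Type)
  | inp (a : Tm ι)
  | arr (a : Tm ι)
  | lt (a b : Tm ι)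
  | bin (f : Bool → Bool → Bool) (φ ψ : Fm ι)
  | ex (i : ι) (φ : Fm ι)
  | iter (i : ι) (φ ψ : Fm ι)

/-- The truth value of a formula for the word `w` and the array `A`. -/
def Fm.eval (w : List Bool) : Fm ι → (ι → ℕ) → List Bool → Bool
  | .inp a, env, _ => w[a.eval w env]? == some true
  | .arr a, env, A => A[a.eval w env]? == some true
  | .lt a b, env, _ => decide (a.eval w env < b.eval w env)
  | .bin f φ ψ, env, A => f (φ.eval w env A) (ψ.eval w env A)
  | .ex i φ, env, A =>
      (List.range w.length).any fun n => φ.eval w (Function.update env i n) A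
  | .iter i φ ψ, env, A =>
      ψ.eval w env ((fun B => (List.range w.length).map fun n =>
        φ.eval w (Function.update env i n) (B ++ A))^[w.length]
          (List.replicate w.length true) ++ A)

/-- Push the bit of `k` at the position on top of the stack of term values on the stack of truth
values. -/
def lookup (k : Stk ι) : Prog (Stk ι) :=
  .seq (whileTrue term (shift k t1)) (.seq (drop term)
    (.seq (test k val fun v => v == some true) (pour t1 k)))

/-- Compare the two numbers on top of the stack of term values. -/
def ltTop : Prog (Stk ι) :=
  .seq (transfer term [t1]) (.seq (drop term) (.seq (whileTrue term (drop t1)) (.seq (drop term)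
    (.seq (test t1 val Option.isSome) (transfer t1 [])))))

/-- Perform `p` for all values of the variable `i` below the length of the input. -/
def forVar (i : ι) (p : Prog (Stk ι)) : Prog (Stk ι) :=
  .seq (push (.var i) false) (.seq (loopN (.seq p (push (.var i) true)))
    (.seq (transfer (.var i) []) (drop (.var i))))

/-- Replace the array on top by the truth values on top. -/
def replaceArr : Prog (Stk ι) := .seq (loopN (drop arr)) (loopN (shift val arr))

/-- Push the truth value of a formula on the stack of truth values. -/
def Fm.prog : Fm ι → Prog (Stk ι)
  | .inp a => .seq a.prog (lookup .inp)
  | .arr a => .seq a.prog (lookup .arr)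
  | .lt a b => .seq a.prog (.seq b.prog ltTop)
  | .bin f φ ψ => .seq φ.prog (.seq ψ.prog (combine val f))
  | .ex i φ => .seq (push val false) (forVar i (.seq φ.prog (combine val or)))
  | .iter i φ ψ => .seq (countIn Stk.arr) (.seq (loopN (.seq (forVar i φ.prog) replaceArr))
      (.seq ψ.prog (loopN (drop Stk.arr))))

/-- The memory with `b` pushed on the stack of truth values. -/
def pushVal (s : Mem (Stk ι)) (b : Bool) : Mem (Stk ι) := Function.update s val (b :: s val)

theorem Ready.update {w : List Bool} {env : ι → ℕ} {s : Mem (Stk ι)} (h : Ready w env s)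
    {k : Stk ι} (hk : k = term ∨ k = val ∨ k = cnt ∨ k = arr) (l : List Bool) :
    Ready w env (Function.update s k l) := by
  rcases hk with rfl | rfl | rfl | rfl <;>
    constructor <;> simp [h.inp, h.t1, h.t2, h.t3, h.var, h.le]

theorem Ready.updateVar {w : List Bool} {env : ι → ℕ} {s : Mem (Stk ι)} (h : Ready w env s)
    (i : ι) {n : ℕ} (hn : n ≤ w.length) (l : List Bool) :
    Ready w (Function.update env i n)
      (Function.update s (.var i) (List.replicate n true ++ false :: l)) := by
  constructor
  · simp [h.inp]
  · simp [h.t1]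
  · simp [h.t2]
  · simp [h.t3]
  · intro j
    by_cases hj : j = i
    · subst hj; simp [ones_replicate]
    · simp [hj, h.var]
  · intro j
    by_cases hj : j = i
    · subst hj; simpa
    · simp [hj, h.le]

/-- The first `n` bits are moved aside to `t1`, the top is tested, and the bits are poured back.
Shifting from an empty stack does nothing, so a position beyond the end reads as false. -/
theorem exec_lookup {w : List Bool} {env : ι → ℕ} {s : Mem (Stk ι)} (h : Ready w env s)
    {k : Stk ι} (hk : k = inp ∨ k = arr) (n : ℕ) :
    Exec (lookup k) (pushNum s n) (pushVal s ((s k)[n]? == some true)) (n * 7 + 5) := by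
  have hkt : k ≠ t1 ∧ k ≠ term ∧ k ≠ val := by rcases hk with rfl | rfl <;> simp
  obtain ⟨ht, hm, hv⟩ := hkt
  have e₁ := exec_whileTrue (k := (term : Stk ι)) (p := shift k t1)
    (fun i j => if j = k then (s k).drop i else if j = t1 then ((s k).take i).reverse
      else if j = term then List.replicate (n - i) true ++ false :: s term else s j) n 3 ?_ ?_
  · refine (e₁.of_eq ?_ rfl le_rfl |>.seq ((exec_drop _ _).seq ((exec_test _ _ _ _).seq
      (exec_pour ht.symm _)))).of_eq rfl ?_ ?_
    · funext j
      by_cases hj : j = k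
      · subst hj; simp [pushNum, hm]
      by_cases hj' : j = t1
      · subst hj'; simp [hj, pushNum, h.t1]
      by_cases hj'' : j = term
      · subst hj''; simp [hj, pushNum]
      simp [pushNum, hj, hj', hj'']
    · funext j
      by_cases hj : j = k
      · subst hj; simp [pushVal, hm, hv, ht, ht.symm]
      by_cases hj' : j = t1
      · subst hj'; simp [pushVal, h.t1]
      by_cases hj'' : j = term
      · subst hj''; simp [hj, pushVal]
      by_cases hj3 : j = val
      · subst hj3; simp [pushVal, hj, hm, List.head?_drop]
      simp [pushVal, hj, hj', hj'', hj3]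
    · simp [ht.symm]
      have : min n (s k).length ≤ n := min_le_left _ _
      omega
  · intro i hi
    obtain ⟨j, hj⟩ : ∃ j, n - i = j + 1 := ⟨n - i - 1, by omega⟩
    refine ⟨by simp [hm.symm, hj, List.replicate_succ], ?_⟩
    refine (exec_shift ht _).of_eq rfl ?_ le_rfl
    have h₁ : ((s k).take (i + 1)).reverse =
        ((s k).drop i).head?.toList ++ ((s k).take i).reverse := by
      rw [List.take_add_one, List.reverse_append, List.head?_drop]
      cases (s k)[i]? <;> rfl
    have h₂ : n - (i + 1) = j := by omega
    funext l
    by_cases hl : l = k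
    · subst hl; simp [hm]
    by_cases hl' : l = t1
    · subst hl'; simp [hl, hm, h₁]
    by_cases hl'' : l = term
    · subst hl''; simp [hl, hj, h₂, List.replicate_succ]
    simp [hl, hl', hl'']
  · simp [hm.symm]

/-- Removing one mark of `b` for each mark of `a` leaves `b - a` marks in truncated subtraction,
which is nonzero iff `a < b`. -/
theorem exec_ltTop {w : List Bool} {env : ι → ℕ} {s : Mem (Stk ι)} (h : Ready w env s) (a b : ℕ) :
    Exec ltTop (pushNum (pushNum s a) b) (pushVal s (decide (a < b))) (b * 7 + a * 3 + 7) := by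
  have e₁ := exec_transfer (a := (term : Stk ι)) (ks := [t1]) (by simp) (by simp)
    (pushNum (pushNum s a) b) b (false :: List.replicate a true ++ false :: s term)
    (by simp [pushNum]) (by simp)
  let st : ℕ → Mem (Stk ι) := fun i k => match k with
    | t1 => List.replicate (b - i) true
    | term => List.replicate (a - i) true ++ false :: s term
    | k => s k
  have e₂ := exec_whileTrue (k := (term : Stk ι)) (p := drop t1) st a 1 ?_ ?_
  · refine (e₁.seq ((exec_drop _ _).seq ((e₂.of_eq ?_ rfl le_rfl).seq ((exec_drop _ _).seq
      ((exec_test _ _ _ _).seq (exec_transfer (a := (t1 : Stk ι)) (ks := []) (by simp) (by simp) _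
      (b - a) [] ?_ ?_)))))).of_eq rfl ?_ ?_
    · funext k
      cases k <;> simp [pushNum, h.t1, st]
    · simp [st]
    · simp
    · funext k
      cases k <;> simp [pushVal, h.t1, st]
      by_cases hab : a < b
      · obtain ⟨d, hd⟩ : ∃ d, b - a = d + 1 := ⟨b - a - 1, by omega⟩
        simp [hab, hd, List.replicate_succ]
      · simp [hab, show b - a = 0 by omega]
    · simp; omega
  · intro i hi
    obtain ⟨j, hj⟩ : ∃ j, a - i = j + 1 := ⟨a - i - 1, by omega⟩
    refine ⟨by simp [st, hj, List.replicate_succ], ?_⟩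
    refine (exec_drop _ _).of_eq rfl ?_ le_rfl
    funext k
    have hj' : a - (i + 1) = j := by omega
    cases k <;> simp [st, hj, hj', List.replicate_succ]
    rfl
  · simp [st]

/-- The variable loop with a family of intermediate states. -/
theorem exec_forVar {i : ι} {p : Prog (Stk ι)} {w : List Bool} {env : ι → ℕ}
    (st : ℕ → Mem (Stk ι)) (t : ℕ) (l C : List Bool) (hst : ∀ n ≤ w.length, Ready w env (st n))
    (hC : ∀ n ≤ w.length, st n cnt = C) (hl : ∀ n ≤ w.length, st n (.var i) = l)
    (h : ∀ n < w.length, ∀ D,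
      Exec p (Function.update (Function.update (st n) (.var i)
          (List.replicate n true ++ false :: l)) cnt D)
        (Function.update (Function.update (st (n + 1)) (.var i)
          (List.replicate n true ++ false :: l)) cnt D) t) :
    Exec (forVar i p) (st 0) (st w.length) (w.length * (t + 11) + 8) := by
  have e₁ := exec_loopN (p := .seq p (push (.var i) true))
    (fun n => Function.update (st n) (.var i) (List.replicate n true ++ false :: l)) w.length (t + 1)
    C ?_ ?_ ?_ ?_
  · refine ((exec_push _ _ _).seq ((e₁.of_eq ?_ rfl le_rfl).seq ((exec_transfer (a := .var i)
      (ks := []) (by simp) (by simp) _ w.length (false :: l) ?_ ?_).seq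
      (exec_drop _ _)))).of_eq rfl ?_ ?_
    · simp [hl]
    · simp
    · simp
    · funext k
      by_cases hk : k = .var i
      · subst hk; simp [hl]
      · simp [hk]
    · simp only [List.length_nil]; ring_nf; omega
  · simp [(hst 0 (by omega)).inp]
  · simp [(hst 0 (by omega)).t1]
  · intro n hn; simp [hC n hn]
  · intro n hn D
    refine ((h n hn D).seq (exec_push _ _ _)).of_eq rfl ?_ le_rfl
    funext k
    by_cases hk : k = .var i
    · subst hk; simp [List.replicate_succ]
    · by_cases hk' : k = cnt
      · subst hk'; simp
      · simp [hk, hk']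

theorem exec_dropArr {w : List Bool} {env : ι → ℕ} {s : Mem (Stk ι)} (h : Ready w env s)
    {B A : List Bool} (hB : B.length = w.length) (hA : s arr = B ++ A) :
    Exec (loopN (drop arr)) s (Function.update s arr A) (w.length * 8 + 5) := by
  refine (exec_loopN (p := drop arr) (fun i => Function.update s arr (B.drop i ++ A)) w.length 1
    (s cnt) ?_ ?_ ?_ ?_).of_eq ?_ ?_ le_rfl
  · simp [h.inp]
  · simp [h.t1]
  · simp
  · intro i hi D
    refine (exec_drop _ _).of_eq rfl ?_ le_rfl
    funext k
    cases k <;> simp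
    rw [List.drop_eq_getElem_cons (by omega)]; rfl
  · simp [← hA]
  · simp [← hB]

/-- The new entries were pushed on `val` in the order of their positions, so the last one is on top.
Moving them singly to `arr` reverses them again and leaves position `0` on top. -/
theorem exec_replaceArr {w : List Bool} {env : ι → ℕ} {s : Mem (Stk ι)} (h : Ready w env s)
    {B B' A V : List Bool} (hB : B.length = w.length) (hB' : B'.length = w.length)
    (hA : s arr = B ++ A) (hV : s val = B'.reverse ++ V) :
    Exec replaceArr s (Function.update (Function.update s val V) arr (B' ++ A))
      (w.length * 18 + 10) := by
  have e := exec_loopN (p := shift (val : Stk ι) arr) (fun i => Function.update (Function.update s val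
    (B'.reverse.drop i ++ V)) arr ((B'.reverse.take i).reverse ++ A)) w.length 3
    (s cnt) ?_ ?_ ?_ ?_
  · refine ((exec_dropArr h hB hA).seq (e.of_eq ?_ rfl le_rfl)).of_eq rfl ?_ ?_
    · simp [← hV]
    · simp [← hB', ← List.length_reverse (as := B'), -List.length_reverse]
    · ring_nf; omega
  · simp [h.inp]
  · simp [h.t1]
  · simp
  · intro i hi D
    refine (exec_shift (by simp) _).of_eq rfl ?_ le_rfl
    have hi' : i < B'.reverse.length := by simpa [hB'] using hi
    obtain ⟨x, h₁, h₂⟩ : ∃ x, (B'.reverse.take (i + 1)).reverse = x :: (B'.reverse.take i).reverse ∧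
        B'.reverse.drop i = x :: B'.reverse.drop (i + 1) := by
      refine ⟨B'.reverse[i], ?_, List.drop_eq_getElem_cons hi'⟩
      rw [List.take_succ_eq_append_getElem hi', List.reverse_append]; rfl
    rw [h₁, h₂]
    funext k
    cases k <;> simp

/-- Formulas are evaluated in polynomial time. -/
theorem Fm.exec_prog (φ : Fm ι) : ∃ P : Polynomial ℕ, ∀ w env s, Ready w env s →
    Exec φ.prog s (pushVal s (φ.eval w env (s Stk.arr))) (P.eval w.length) := by
  induction φ with
  | inp a =>
    obtain ⟨P, Q, ha⟩ := a.exec_prog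
    refine ⟨P + Q * 7 + 5, fun w env s h => ?_⟩
    obtain ⟨h₁, h₂⟩ := ha w env s h
    refine (h₂.seq (exec_lookup h (.inl rfl) _)).of_eq rfl ?_ ?_
    · rw [h.inp]; rfl
    · simp; omega
  | arr a =>
    obtain ⟨P, Q, ha⟩ := a.exec_prog
    refine ⟨P + Q * 7 + 5, fun w env s h => ?_⟩
    obtain ⟨h₁, h₂⟩ := ha w env s h
    refine (h₂.seq (exec_lookup h (.inr rfl) _)).of_eq rfl rfl ?_
    simp; omega
  | lt a b =>
    obtain ⟨P, Q, ha⟩ := a.exec_prog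
    obtain ⟨P', Q', hb⟩ := b.exec_prog
    refine ⟨P + P' + Q' * 7 + Q * 3 + 7, fun w env s h => ?_⟩
    obtain ⟨h₁, h₂⟩ := ha w env s h
    obtain ⟨h₃, h₄⟩ := hb w env _ (h.pushNum (a.eval w env))
    refine (h₂.seq (h₄.seq (exec_ltTop h _ _))).of_eq rfl rfl ?_
    simp; omega
  | bin f φ ψ ihφ ihψ =>
    obtain ⟨P, hφ⟩ := ihφ
    obtain ⟨P', hψ⟩ := ihψ
    refine ⟨P + P' + 4, fun w env s h => ?_⟩
    refine ((hφ w env s h).seq ((hψ w env _ (h.update (.inr (.inl rfl)) _)).seq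
      (exec_combine _ _ _ (φ.eval w env (s Stk.arr)) (ψ.eval w env (s Stk.arr)) (s val)
        ?_))).of_eq rfl ?_ ?_
    · simp [pushVal]
    · simp [pushVal, Fm.eval]
    · simp; omega
  | ex i φ ih =>
    obtain ⟨P, hφ⟩ := ih
    refine ⟨.X * (P + 15) + 9, fun w env s h => ?_⟩
    -- The invariant: before round `n` the top truth value is the disjunction over all values below
    -- `n`.
    have e := exec_forVar (i := i) (p := .seq φ.prog (combine val or)) (w := w) (env := env)
      (fun n => pushVal s ((List.range n).any fun n =>
        φ.eval w (Function.update env i n) (s Stk.arr))) (P.eval w.length + 4) (s (.var i)) (s cnt)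
      (fun n _ => h.update (.inr (.inl rfl)) _) (fun n _ => by simp [pushVal])
      (fun n _ => by simp [pushVal]) ?_
    · refine ((exec_push val false s).seq (e.of_eq ?_ rfl le_rfl)).of_eq rfl ?_ ?_
      · simp [pushVal]
      · simp [Fm.eval]
      · simp; ring_nf; omega
    · intro n hn D
      refine ((hφ w (Function.update env i n) _ (((h.update (.inr (.inl rfl)) _).updateVar i hn.le
        _).update (.inr (.inr (.inl rfl))) _)).seq (exec_combine _ _ _
          ((List.range n).any fun n => φ.eval w (Function.update env i n) (s Stk.arr))
          (φ.eval w (Function.update env i n) (s Stk.arr)) (s val) ?_)).of_eq rfl ?_ le_rfl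
      · simp [pushVal]
      · funext k
        by_cases hk : k = .var i
        · subst hk; simp [pushVal]
        · cases k <;> simp_all [pushVal, List.range_succ]
  | iter i φ ψ ihφ ihψ =>
    obtain ⟨P, hφ⟩ := ihφ
    obtain ⟨P', hψ⟩ := ihψ
    -- The summands pay for creating the all-true array, for one evaluation of all entries and one
    -- replacement per position, for `ψ`, and for discarding the array.
    refine ⟨.X * 5 + 2 + (.X * (.X * (P + 11) + 8 + (.X * 18 + 10) + 7) + 5) + P' + (.X * 8 + 5),
      fun w env s h => ?_⟩
    let F : List Bool → List Bool := fun B => (List.range w.length).map fun n =>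
        φ.eval w (Function.update env i n) (B ++ s Stk.arr)
    -- The array after `m` rounds; it always lies above the array `s Stk.arr` of the surrounding
    -- formula.
    let W : ℕ → List Bool := fun m => F^[m] (List.replicate w.length true)
    have hWs : ∀ m, W (m + 1) = F (W m) := fun m => Function.iterate_succ_apply' F m _
    have hW : ∀ m, (W m).length = w.length := by
      intro m
      rcases m with _ | m
      · simp [W]
      · simp [hWs, F]
    have e := exec_loopN (p := .seq (forVar i φ.prog) replaceArr)
      (fun m => Function.update s Stk.arr (W m ++ s Stk.arr)) w.length
      (w.length * (P.eval w.length + 11) + 8 + (w.length * 18 + 10)) (s cnt) (by simp [h.inp])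
      (by simp [h.t1]) (by simp) ?_
    · have hr := h.update (.inr (.inr (.inr rfl))) (W w.length ++ s Stk.arr)
      have hr' : Ready w env (pushVal (Function.update s Stk.arr (W w.length ++ s Stk.arr))
          (ψ.eval w env (W w.length ++ s Stk.arr))) := hr.update (.inr (.inl rfl)) _
      refine ((exec_countIn (k := Stk.arr) (by simp) (by simp) s h.t1).seq
        ((e.of_eq ?_ rfl le_rfl).seq (((hψ w env _ hr).of_eq rfl ?_ le_rfl).seq
          (exec_dropArr hr' (hW w.length) (A := s Stk.arr) ?_)))).of_eq rfl ?_ ?_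
      · simp [W, h.inp]
      · simp
      · simp [pushVal]
      · funext k
        cases k <;> simp [pushVal, Fm.eval]
        rfl
      · simp [h.inp]; omega
    · intro m hm D
      have hr : Ready w env (Function.update (Function.update s Stk.arr (W m ++ s Stk.arr)) cnt D) :=
        (h.update (.inr (.inr (.inr rfl))) _).update (.inr (.inr (.inl rfl))) _
      have e' := exec_forVar (i := i) (p := φ.prog) (w := w) (env := env)
        (fun n => Function.update (Function.update (Function.update s Stk.arr (W m ++ s Stk.arr))
          cnt D) val (((List.range n).map fun n =>
            φ.eval w (Function.update env i n) (W m ++ s Stk.arr)).reverse ++ s val))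
        (P.eval w.length) (s (.var i)) D (fun n _ => hr.update (.inr (.inl rfl)) _)
        (fun n _ => by simp) (fun n _ => by simp) ?_
      · refine (e'.of_eq ?_ rfl le_rfl |>.seq (exec_replaceArr (hr.update (.inr (.inl rfl)) _)
          (hW m) (B' := F (W m)) (A := s Stk.arr) (V := s val) (by simp [F]) ?_ ?_)).of_eq rfl ?_ ?_
        · simp
        · simp
        · simp [F]
        · funext k
          cases k <;> simp [hWs]
        · simp
      · intro n hn D'
        refine (hφ w (Function.update env i n) _ ((((hr.update (.inr (.inl rfl)) _).updateVar i
          hn.le _).update (.inr (.inr (.inl rfl))) _))).of_eq rfl ?_ le_rfl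
        funext k
        by_cases hk : k = .var i
        · subst hk; simp [pushVal]
        · cases k <;> simp_all [pushVal, List.range_succ]

/-- Evaluate a formula, and clear the input. -/
def Fm.decider (φ : Fm ι) : Prog (Stk ι) := .seq φ.prog (loopN (drop Stk.inp))

/-- A property of words expressed by a formula is decided in polynomial time. -/
theorem Fm.computable [Fintype ι] (φ : Fm ι) :
    Nonempty (TM2ComputableInPolyTime (id : List Bool → List Bool) Computability.encodeBool
      fun w => φ.eval w (fun _ => 0) []) := by
  obtain ⟨P, hP⟩ := φ.exec_prog
  refine computable_of_exec φ.decider Stk.inp val _ (P + (.X * 8 + 5)) fun w => ?_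
  have hs : Ready w (fun _ => 0) (single (Stk.inp : Stk ι) w) := by
    constructor <;> simp [single, ones]
  have e := exec_loopN (p := drop Stk.inp) (fun i => Function.update
    (pushVal (single (Stk.inp : Stk ι) w) (φ.eval w (fun _ => 0) [])) Stk.inp (w.drop i))
    w.length 1 [] (by simp) (by simp [pushVal, single]) (by simp [pushVal, single]) ?_
  · refine ((hP w _ _ hs).seq (e.of_eq ?_ rfl le_rfl)).of_eq rfl ?_ ?_
    · funext k
      cases k <;> simp [pushVal, single]
    · funext k
      cases k <;> simp [pushVal, single]
    · simp
  · intro i hi D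
    refine (exec_drop _ _).of_eq rfl ?_ le_rfl
    funext k
    cases k <;> simp

end StackProg

/-! ### Combinatorial characterization of relevance -/

namespace ArgFW

variable {V : Type} [DecidableEq V]

/-! ### Extensions as labellings -/

/-- In the framework with arguments `D` and attacks `T`, the members of `W` are exactly the
arguments outside `S` not attacked by `S`, and `S` is a `σ`-extension. -/
structure Lab (σ : Semantics) (D : V → Prop) (T : V → V → Prop) (S : Finset V) (W : V → Prop) :
    Prop where
  sub : ∀ u ∈ S, D u
  undec : ∀ u, W u → D u ∧ u ∉ S
  free : ∀ s ∈ S, ∀ s' ∈ S, ¬ T s s'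
  out : ∀ u, D u → u ∉ S → ¬ W u → ∃ s ∈ S, T s u
  notTo : ∀ u, W u → ∀ s ∈ S, ¬ T s u
  notFrom : ∀ u, W u → ∀ s ∈ S, ¬ T u s
  stable : σ = .st → ∀ u, ¬ W u
  complete : σ = .co → ∀ u, W u → ∃ b, W b ∧ T b u

/-- `S` is a `σ`-extension of the framework with arguments `D` and attacks `T`. -/
def Ext (σ : Semantics) (D : V → Prop) (T : V → V → Prop) (S : Finset V) : Prop :=
  ∃ W, Lab σ D T S W

/-- The set `W` is forced to be the set of arguments that `S` neither contains nor attacks. An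
attacker of `S` must be attacked by `S`, so no attack leads from `W` to `S`; an argument of `W` is
undefended iff one of its attackers is again in `W`. Only attacks between present arguments matter,
so `T` is arbitrary elsewhere. -/
theorem isExtension_iff {σ : Semantics} {F : AF V} {S : Finset V} {D : V → Prop}
    {T : V → V → Prop} (hD : ∀ u, u ∈ F.args ↔ D u)
    (hT : ∀ b a, D b → D a → ((b, a) ∈ F.att ↔ T b a)) :
    IsExtension σ F S ↔ Ext σ D T S := by
  have hplus : S ⊆ F.args → ∀ a, a ∈ F.plus S ↔ D a ∧ ∃ s ∈ S, T s a := by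
    intro hS a
    simp only [AF.plus, Finset.mem_filter, hD]
    constructor
    · rintro ⟨ha, s, hs, h⟩
      exact ⟨ha, s, hs, (hT _ _ ((hD _).1 (hS hs)) ha).1 h⟩
    · rintro ⟨ha, s, hs, h⟩
      exact ⟨ha, s, hs, (hT _ _ ((hD _).1 (hS hs)) ha).2 h⟩
  have hchar : S ⊆ F.args → ∀ a, a ∈ F.charFun S ↔ D a ∧ ∀ b, D b → T b a → ∃ s ∈ S, T s b := by
    intro hS a
    rw [AF.charFun, Finset.mem_filter]
    simp only [AF.Defends, hD]
    refine and_congr_right fun ha => ⟨fun h b hb hba => ?_, fun h b hb hba => ?_⟩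
    · exact ((hplus hS b).1 (h b hb ((hT _ _ hb ha).2 hba))).2
    · exact (hplus hS b).2 ⟨hb, h b hb ((hT _ _ hb ha).1 hba)⟩
  have hfree : S ⊆ F.args → (F.ConflictFree S ↔ ∀ s ∈ S, ∀ s' ∈ S, ¬ T s s') := by
    intro hS
    rw [AF.ConflictFree, Finset.eq_empty_iff_forall_notMem]
    simp only [Finset.mem_inter, hplus hS]
    constructor
    · intro h s hs s' hs' hT'
      exact h s' ⟨hs', (hD _).1 (hS hs'), s, hs, hT'⟩
    · rintro h s' ⟨hs', -, s, hs, hT'⟩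
      exact h s hs s' hs' hT'
  constructor
  · rintro ⟨hS, h⟩
    have hSD : ∀ u ∈ S, D u := fun u hu => (hD u).1 (hS hu)
    refine ⟨fun u => D u ∧ u ∉ S ∧ ∀ s ∈ S, ¬ T s u, hSD, fun u hu => ⟨hu.1, hu.2.1⟩, ?_, ?_,
      fun u hu => hu.2.2, ?_, ?_, ?_⟩
    · rw [← hfree hS]
      rcases σ with _ | _ | _
      exacts [h.1, h.1, h.1.1]
    · intro u hu hus hW
      by_contra! hne
      exact hW ⟨hu, hus, hne⟩
    -- An attacker of `S` is attacked by `S`: by defence under admissible and complete semantics,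
    -- and as an argument outside `S` under stable semantics.
    · intro u hu s hs hT'
      have hd : S ⊆ F.charFun S → False := by
        intro hsub
        obtain ⟨s', hs', hT''⟩ := ((hchar hS s).1 (hsub hs)).2 u hu.1 hT'
        exact hu.2.2 s' hs' hT''
      rcases σ with _ | _ | _
      · exact hd h.2
      · have : u ∈ F.plus S := by
          rw [h.2, Finset.mem_sdiff, hD]; exact ⟨hu.1, hu.2.1⟩
        obtain ⟨-, s', hs', hT''⟩ := (hplus hS u).1 this
        exact hu.2.2 s' hs' hT''
      · exact hd h.1.2
    · rintro rfl u hu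
      have : u ∈ F.plus S := by
        rw [h.2, Finset.mem_sdiff, hD]; exact ⟨hu.1, hu.2.1⟩
      obtain ⟨-, s', hs', hT''⟩ := (hplus hS u).1 this
      exact hu.2.2 s' hs' hT''
    · rintro rfl u hu
      -- Completeness leaves `u` undefended, so some attacker `b` is not attacked by `S`. It is not
      -- in `S` either, because `S` does not attack `u`; hence it is undecided.
      have hn : u ∉ F.charFun S := fun hc => hu.2.1 (h.2 u hc)
      rw [hchar hS] at hn
      push Not at hn
      obtain ⟨b, hb, hbu, hbs⟩ := hn hu.1
      exact ⟨b, ⟨hb, fun hbS => hu.2.2 b hbS hbu, hbs⟩, hbu⟩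
  · rintro ⟨W, hW⟩
    have hS : S ⊆ F.args := fun u hu => (hD u).2 (hW.sub u hu)
    refine ⟨hS, ?_⟩
    have hcf := (hfree hS).2 hW.free
    have had : S ⊆ F.charFun S := by
      intro s hs
      refine (hchar hS s).2 ⟨hW.sub s hs, fun b hb hbs => hW.out b hb ?_ ?_⟩
      · exact fun hbS => hW.free b hbS s hs hbs
      · exact fun hWb => hW.notFrom b hWb s hs hbs
    rcases σ with _ | _ | _
    · exact ⟨hcf, had⟩
    · refine ⟨hcf, ?_⟩
      ext u
      rw [hplus hS, Finset.mem_sdiff, hD]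
      constructor
      · rintro ⟨hu, s, hs, hT'⟩
        exact ⟨hu, fun huS => hW.free s hs u huS hT'⟩
      · rintro ⟨hu, huS⟩
        exact ⟨hu, hW.out u hu huS (hW.stable rfl u)⟩
    · refine ⟨⟨hcf, had⟩, fun a ha => ?_⟩
      rw [hchar hS] at ha
      by_contra haS
      by_cases hWa : W a
      · obtain ⟨b, hb, hba⟩ := hW.complete rfl a hWa
        obtain ⟨s, hs, hsb⟩ := ha.2 b (hW.undec b hb).1 hba
        exact hW.notTo b hb s hs hsb
      · obtain ⟨s, hs, hsa⟩ := hW.out a ha.1 haS hWa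
        obtain ⟨s', hs', hT'⟩ := ha.2 s (hW.sub s hs) hsa
        exact hW.free s' hs' s hs hT'

/-! ### Relevance by means of completions -/

/-- `D` and `T` are the arguments and attacks of a completion of `I`. -/
structure Completes (I : IAF V) (D : V → Prop) (T : V → V → Prop) : Prop where
  certArg : ∀ u ∈ I.A, D u
  possArg : ∀ u, D u → u ∈ I.A ∪ I.AQ
  certAtt : ∀ b a, (b, a) ∈ I.R → T b a
  possAtt : ∀ b a, T b a → (b, a) ∈ I.R ∪ I.RQ

/-- The element `e` can be present among the arguments `D`. -/
def Pres (D : V → Prop) : V ⊕ V × V → Prop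
  | .inl a => D a
  | .inr r => D r.1 ∧ D r.2

/-- `S` is an extension of the framework with the element `e`. -/
def ExtWith (σ : Semantics) (D : V → Prop) (T : V → V → Prop) (S : Finset V) (e : V ⊕ V × V) :
    Prop :=
  Ext σ D (fun b a => T b a ∨ e = .inr (b, a)) S

/-- `S` is an extension of the framework without the element `e`. -/
def ExtWithout (σ : Semantics) (D : V → Prop) (T : V → V → Prop) (S : Finset V)
    (e : V ⊕ V × V) : Prop :=
  Ext σ (fun u => D u ∧ e ≠ .inl u) (fun b a => T b a ∧ e ≠ .inr (b, a)) S

/-- The framework with and the framework without the last uncertain element. -/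
theorem isExtension_cert_iff {I' : IAF V} {e : V ⊕ V × V} (he : I'.uncertain = {e})
    {D : V → Prop} {T : V → V → Prop} (hD : ∀ u, D u ↔ u ∈ I'.A ∪ I'.AQ)
    (hT : ∀ b a, D b → D a → e ≠ .inr (b, a) → (T b a ↔ (b, a) ∈ I'.R)) (σ : Semantics)
    (S : Finset V) :
    (IsExtension σ (I'.add e).cert S ↔ ExtWith σ D T S e) ∧
      (IsExtension σ (I'.remove e).cert S ↔ ExtWithout σ D T S e) := by
  have hA : ∀ u, u ∈ I'.AQ ↔ e = .inl u := by
    intro u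
    have := Finset.ext_iff.1 he (.inl u)
    simpa [IAF.uncertain, eq_comm] using this
  have hR : ∀ r, r ∈ I'.RQ ↔ e = .inr r := by
    intro r
    have := Finset.ext_iff.1 he (.inr r)
    simpa [IAF.uncertain, eq_comm] using this
  have hdis := Finset.disjoint_left.1 I'.disjoint_args
  have hdis' := Finset.disjoint_left.1 I'.disjoint_atts
  constructor
  · refine isExtension_iff ?_ ?_
    · intro u
      rcases e with a | r
      · simp [IAF.cert, IAF.add, IAF.addArgs, hD, hA, or_comm, eq_comm]
      · simp [IAF.cert, IAF.add, IAF.addAttacks, hD, hA]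
    · intro b a hb ha
      have h := hT b a hb ha
      rw [hD] at hb ha
      rcases e with c | r
      · simp_all [IAF.cert, IAF.add, IAF.addArgs]
        grind
      · by_cases hr : r = (b, a)
        · subst hr
          simp_all [IAF.cert, IAF.add, IAF.addAttacks]
        · simp_all [IAF.cert, IAF.add, IAF.addAttacks, eq_comm]
  · refine isExtension_iff ?_ ?_
    · intro u
      have := @hdis u
      rcases e with a | r
      · simp [IAF.cert, IAF.remove, IAF.removeArgs, hD, hA] at this ⊢
        grind
      · simp [IAF.cert, IAF.remove, IAF.removeAttacks, hD, hA]
    · intro b a hb ha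
      have h := hT b a hb.1 ha.1
      have h' := @hdis' (b, a)
      rw [hD] at hb ha
      rcases e with c | r
      · simp_all [IAF.cert, IAF.remove, IAF.removeArgs]
        grind
      · by_cases hr : r = (b, a)
        · subst hr
          simp_all [IAF.cert, IAF.remove, IAF.removeAttacks]
        · simp_all [IAF.cert, IAF.remove, IAF.removeAttacks, eq_comm]

/-- A partial completion whose only uncertain element is `e` amounts to a completion `(D, T)` in
which `e` can be present. Whether `T` itself contains the attack `e` is immaterial, since `ExtWith`
and `ExtWithout` override it. -/
theorem relevant_iff {I : IAF V} {S : Finset V} {e : V ⊕ V × V} (he : e ∈ I.uncertain)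
    (σ : Semantics) (c : Act) :
    Relevant ⟨σ, true⟩ I S c e ↔ ∃ D T, Completes I D T ∧ Pres D e ∧
      match c with
      | .addition => ExtWith σ D T S e ∧ ¬ ExtWithout σ D T S e
      | .removal => ExtWithout σ D T S e ∧ ¬ ExtWith σ D T S e := by
  classical
  constructor
  · rintro ⟨I', ⟨⟨h₁, h₂⟩, ⟨h₃, h₄⟩, h₅, h₆⟩, hu, h₇⟩
    -- A partial completion may omit certain attacks whose endpoints are absent, whereas `Completes`
    -- wants all certain attacks. Putting them back changes no attack between present arguments.
    have hkey := isExtension_cert_iff hu (D := fun u => u ∈ I'.A ∪ I'.AQ)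
      (T := fun b a => (b, a) ∈ I'.R ∨ (b, a) ∈ I.R) (fun u => Iff.rfl) ?_ σ S
    · refine ⟨fun u => u ∈ I'.A ∪ I'.AQ, fun b a => (b, a) ∈ I'.R ∨ (b, a) ∈ I.R,
        ⟨?_, ?_, ?_, ?_⟩, ?_, ?_⟩
      rotate_right
      · rcases c with _ | _
        · simpa [HasStatus, Act.apply, Act.opposite, hkey.1, hkey.2] using h₇
        · simpa [HasStatus, Act.apply, Act.opposite, hkey.1, hkey.2] using h₇
      · intro u hu'
        exact Finset.mem_union_left _ (h₁ hu')
      · intro u hu'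
        rcases Finset.mem_union.1 hu' with h | h
        · exact h₂ h
        · exact Finset.mem_union_right _ (h₅ h)
      · intro b a h; exact Or.inr h
      · rintro b a (h | h)
        · exact h₄ h
        · exact Finset.mem_union_left _ h
      · have he' : e ∈ I'.uncertain := by rw [hu]; exact Finset.mem_singleton_self e
        rcases e with a | r
        · simp [IAF.uncertain] at he'
          simp [Pres, he']
        · simp [IAF.uncertain] at he'
          exact Finset.mem_product.1 (I'.RQ_subset he')
    · intro b a hb ha _
      refine ⟨fun h => h.elim id fun h => ?_, Or.inl⟩
      exact h₃ (Finset.mem_inter.2 ⟨h, Finset.mem_product.2 ⟨hb, ha⟩⟩)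
  · rintro ⟨D, T, hC, hp, h⟩
    have hRU : ∀ r, r ∈ I.R ∪ I.RQ → D r.1 → D r.2 → r.1 ∈ I.A ∪ I.AQ ∧ r.2 ∈ I.A ∪ I.AQ :=
      fun r _ h h' => ⟨hC.possArg _ h, hC.possArg _ h'⟩
    -- All elements but `e` are decided by `D` and `T`. Attacks with an absent endpoint are dropped,
    -- as an incomplete framework allows none.
    let I' : IAF V :=
      { A := (I.A ∪ I.AQ).filter fun u => D u ∧ e ≠ .inl u
        AQ := (I.A ∪ I.AQ).filter fun u => D u ∧ e = .inl u
        R := (I.R ∪ I.RQ).filter fun r => D r.1 ∧ D r.2 ∧ T r.1 r.2 ∧ e ≠ .inr r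
        RQ := (I.R ∪ I.RQ).filter fun r => D r.1 ∧ D r.2 ∧ e = .inr r
        disjoint_args := by
          rw [Finset.disjoint_left]; simp +contextual
        disjoint_atts := by
          rw [Finset.disjoint_left]; simp +contextual
        R_subset := by
          intro r hr
          rw [Finset.mem_filter] at hr
          have := hRU r hr.1 hr.2.1 hr.2.2.1
          simp only [Finset.mem_product, Finset.mem_union, Finset.mem_filter] at this ⊢
          tauto
        RQ_subset := by
          intro r hr
          rw [Finset.mem_filter] at hr
          have := hRU r hr.1 hr.2.1 hr.2.2.1
          simp only [Finset.mem_product, Finset.mem_union, Finset.mem_filter] at this ⊢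
          tauto }
    have hD : ∀ u, D u ↔ u ∈ I'.A ∪ I'.AQ := by
      intro u
      have := hC.possArg u
      simp only [I', Finset.mem_union, Finset.mem_filter] at this ⊢
      tauto
    have hT : ∀ b a, D b → D a → e ≠ .inr (b, a) → (T b a ↔ (b, a) ∈ I'.R) := by
      intro b a hb ha hne
      have := hC.possAtt b a
      simp only [I', Finset.mem_filter] at this ⊢
      tauto
    have hu : I'.uncertain = {e} := by
      ext z
      rcases z with z | z
      · simp only [IAF.uncertain, I', Finset.inl_mem_disjSum, Finset.mem_filter,
          Finset.mem_singleton, eq_comm (a := Sum.inl z)]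
        refine ⟨fun h => h.2.2, ?_⟩
        rintro rfl
        exact ⟨hC.possArg _ hp, hp, rfl⟩
      · simp only [IAF.uncertain, I', Finset.inr_mem_disjSum, Finset.mem_filter,
          Finset.mem_singleton, eq_comm (a := Sum.inr z)]
        refine ⟨fun h => h.2.2.2, ?_⟩
        rintro rfl
        refine ⟨?_, hp.1, hp.2, rfl⟩
        exact Finset.mem_union_right _ (by simpa [IAF.uncertain] using he)
    have hkey := isExtension_cert_iff hu hD hT σ S
    refine ⟨I', ⟨⟨?_, ?_⟩, ⟨?_, ?_⟩, ?_, ?_⟩, hu, ?_⟩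
    · intro u hu'
      have h₁ := hC.certArg u hu'
      have h₂ : e ≠ .inl u := by
        rintro rfl
        exact Finset.disjoint_left.1 I.disjoint_args hu' (by simpa [IAF.uncertain] using he)
      simp [I', hu', h₁, h₂]
    · exact Finset.filter_subset _ _
    · rintro ⟨b, a⟩ hr
      rw [Finset.mem_inter, Finset.mem_product, ← hD, ← hD] at hr
      have h₂ : e ≠ .inr (b, a) := by
        rintro rfl
        exact Finset.disjoint_left.1 I.disjoint_atts hr.1 (by simpa [IAF.uncertain] using he)
      exact (hT b a hr.2.1 hr.2.2 h₂).1 (hC.certAtt _ _ hr.1)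
    · exact Finset.filter_subset _ _
    · intro u hu'
      rw [Finset.mem_filter] at hu'
      have := hu'.2.2
      subst this
      simpa [IAF.uncertain] using he
    · intro u hu'
      rw [Finset.mem_filter] at hu'
      have := hu'.2.2.2
      subst this
      simpa [IAF.uncertain] using he
    · rcases c with _ | _
      · simpa [HasStatus, Act.apply, Act.opposite, hkey.1, hkey.2] using h
      · simpa [HasStatus, Act.apply, Act.opposite, hkey.1, hkey.2] using h

/-- Negating the status exchanges the roles of the two frameworks being compared, and so does
passing to the opposite action. -/
theorem relevant_false_iff {I : IAF V} {S : Finset V} {e : V ⊕ V × V} (σ : Semantics) (c : Act) :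
    Relevant ⟨σ, false⟩ I S c e ↔ Relevant ⟨σ, true⟩ I S c.opposite e := by
  have h : c.opposite.opposite = c := by cases c <;> rfl
  simp only [Relevant, HasStatus, h, not_not]
  refine exists_congr fun I' => ?_
  tauto

end ArgFW

namespace ArgFW

variable {V : Type} [DecidableEq V]

/-! ### Completions by means of sets of undecided arguments -/

/-- `W` can be the set of undecided arguments of a completion, and avoids `X`. -/
structure Good (σ : Semantics) (I : IAF V) (S : Finset V) (X W : V → Prop) : Prop where
  arg : ∀ u, W u → u ∈ I.A ∪ I.AQ
  notMem : ∀ u, W u → u ∉ S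
  notTo : ∀ u, W u → ∀ s ∈ S, (s, u) ∉ I.R
  notFrom : ∀ u, W u → ∀ s ∈ S, (u, s) ∉ I.R
  avoid : ∀ u, W u → ¬ X u
  stable : σ = .st → ∀ u, ¬ W u
  complete : σ = .co → ∀ u, W u → ∃ b, W b ∧ (b, u) ∈ I.R ∪ I.RQ

/-- Apart from `Y`, the certain arguments that are neither in `S` nor in `W` can be attacked by
`S`. -/
structure Check (I : IAF V) (S : Finset V) (Y W : V → Prop) : Prop where
  free : ∀ s ∈ S, ∀ s' ∈ S, (s, s') ∉ I.R
  out : ∀ u ∈ I.A, u ∉ S → ¬ Y u → ¬ W u → ∃ s ∈ S, (s, u) ∈ I.R ∪ I.RQ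

/-- Some set of undecided arguments avoids `X`, contains `Z`, and settles everything but `Y`. -/
def Verif (σ : Semantics) (I : IAF V) (S : Finset V) (X Y Z : V → Prop) : Prop :=
  ∃ W, Good σ I S X W ∧ Check I S Y W ∧ ∀ u, Z u → W u

/-- `S` is an extension in some completion. -/
def PossExt (σ : Semantics) (I : IAF V) (S : Finset V) : Prop :=
  Verif σ I S (fun _ => False) (fun _ => False) (fun _ => False)

/-- `S` is an extension in some completion where `x` is undecided. -/
def PossUndec (σ : Semantics) (I : IAF V) (S : Finset V) (x : V) : Prop :=
  Verif σ I S (fun _ => False) (fun _ => False) (fun u => u = x)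

/-- `S` is an extension in some completion where `x` is the only undecided attacker of the
undecided argument `y`. -/
def PossSole (I : IAF V) (S : Finset V) (x y : V) : Prop :=
  (x, y) ∈ I.R ∪ I.RQ ∧
    Verif .co I S (fun b => b ≠ x ∧ (b, y) ∈ I.R) (fun _ => False) (fun u => u = x ∨ u = y)

/-- In some completion only the argument `y`, which is not attacked by `S`, prevents `S` from
being an extension. -/
def PossBlock (σ : Semantics) (I : IAF V) (S : Finset V) (y : V) : Prop :=
  y ∉ S ∧ (∀ s ∈ S, (s, y) ∉ I.R) ∧
    ((σ = .st ∨ ∃ s ∈ S, (y, s) ∈ I.R ∪ I.RQ) ∧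
        Verif σ I S (fun u => u = y) (fun u => u = y) (fun _ => False) ∨
      σ = .co ∧ (y, y) ∉ I.R ∧
        Verif σ I S (fun u => u = y ∨ (u, y) ∈ I.R) (fun u => u = y) (fun _ => False))

theorem Lab.good {σ : Semantics} {I : IAF V} {S : Finset V} {D : V → Prop} {T : V → V → Prop}
    {W X : V → Prop} (h : Lab σ D T S W) (hD : ∀ u, D u → u ∈ I.A ∪ I.AQ)
    (hT : ∀ b a, (b, a) ∈ I.R → T b a) (hT' : ∀ b a, T b a → (b, a) ∈ I.R ∪ I.RQ)
    (hX : ∀ u, W u → ¬ X u) : Good σ I S X W where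
  arg u hu := hD u (h.undec u hu).1
  notMem u hu := (h.undec u hu).2
  notTo u hu s hs hR := h.notTo u hu s hs (hT _ _ hR)
  notFrom u hu s hs hR := h.notFrom u hu s hs (hT _ _ hR)
  avoid := hX
  stable := h.stable
  complete hσ u hu :=
    let ⟨b, hb, hbu⟩ := h.complete hσ u hu
    ⟨b, hb, hT' _ _ hbu⟩

theorem Lab.check {σ : Semantics} {I : IAF V} {S : Finset V} {D : V → Prop} {T : V → V → Prop}
    {W Y : V → Prop} (h : Lab σ D T S W) (hD : ∀ u ∈ I.A, ¬ Y u → D u)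
    (hT : ∀ b a, (b, a) ∈ I.R → T b a) (hT' : ∀ b a, T b a → (b, a) ∈ I.R ∪ I.RQ) :
    Check I S Y W where
  free s hs s' hs' hR := h.free s hs s' hs' (hT _ _ hR)
  out u hu huS huY huW :=
    let ⟨s, hs, hsu⟩ := h.out u (hD u hu huY) huS huW
    ⟨s, hs, hT' _ _ hsu⟩

/-- If `S` is an extension as long as `y` is absent, then `y` can block `S`. -/
theorem Lab.possBlock {σ : Semantics} {I : IAF V} {S : Finset V} {D : V → Prop}
    {T : V → V → Prop} {W : V → Prop} {y : V} (h : Lab σ (fun u => D u ∧ y ≠ u) T S W)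
    (hA : ∀ u ∈ I.A, D u) (hD : ∀ u, D u → u ∈ I.A ∪ I.AQ)
    (hT : ∀ b a, (b, a) ∈ I.R → T b a) (hT' : ∀ b a, T b a → (b, a) ∈ I.R ∪ I.RQ)
    (hy : D y) (hext : ¬ Ext σ D T S) : PossBlock σ I S y := by
  have hyS : y ∉ S := fun hyS => (h.sub y hyS).2 rfl
  have hyW : ¬ W y := fun hyW => (h.undec y hyW).1.2 rfl
  -- If `S` attacked `y`, the presence of `y` would be harmless: the same `W` would still be a
  -- labelling.
  have hyT : ∀ s ∈ S, ¬ T s y := by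
    intro s hs hsy
    refine hext ⟨W, ⟨fun u hu => (h.sub u hu).1, fun u hu => ⟨(h.undec u hu).1.1,
      (h.undec u hu).2⟩, h.free, fun u hu huS huW => ?_, h.notTo, h.notFrom, h.stable,
      h.complete⟩⟩
    by_cases huy : y = u
    · subst huy; exact ⟨s, hs, hsy⟩
    · exact h.out u ⟨hu, huy⟩ huS huW
  have hcheck : Check I S (fun u => u = y) W :=
    h.check (fun u hu huy => ⟨hA u hu, Ne.symm huy⟩) hT hT'
  refine ⟨hyS, fun s hs hR => hyT s hs (hT _ _ hR), ?_⟩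
  by_cases hcase : σ = .st ∨ ∃ s ∈ S, (y, s) ∈ I.R ∪ I.RQ
  · refine .inl ⟨hcase, W, h.good (fun u hu => hD u hu.1) hT hT' ?_, hcheck, fun _ h => h.elim⟩
    rintro u hu rfl
    exact hyW hu
  · push Not at hcase
    -- Here `y` cannot attack `S` and undecided arguments are allowed, so `y` could just join `W`.
    -- The only obstacle is complete semantics when `y` has no undecided attacker, itself included.
    have hlab : (σ = .co → ∃ b, (W b ∨ b = y) ∧ T b y) → False := by
      intro hco
      refine hext ⟨fun u => W u ∨ u = y, ⟨fun u hu => (h.sub u hu).1, ?_, h.free, ?_, ?_, ?_,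
        fun hσ => (hcase.1 hσ).elim, ?_⟩⟩
      · rintro u (hu | rfl)
        · exact ⟨(h.undec u hu).1.1, (h.undec u hu).2⟩
        · exact ⟨hy, hyS⟩
      · intro u hu huS huW
        exact h.out u ⟨hu, fun hyu => huW (.inr hyu.symm)⟩ huS fun h => huW (.inl h)
      · rintro u (hu | rfl)
        · exact h.notTo u hu
        · exact hyT
      · rintro u (hu | rfl) s hs hus
        · exact h.notFrom u hu s hs hus
        · exact hcase.2 s hs (hT' _ _ hus)
      · rintro hσ u (hu | rfl)
        · obtain ⟨b, hb, hbu⟩ := h.complete hσ u hu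
          exact ⟨b, .inl hb, hbu⟩
        · exact hco hσ
    have hσ : σ = .co := by
      by_contra hσ
      exact hlab fun h => (hσ h).elim
    refine .inr ⟨hσ, fun hyy => hlab fun _ => ⟨y, .inr rfl, hT _ _ hyy⟩, W,
      h.good (fun u hu => hD u hu.1) hT hT' ?_, hcheck, fun _ h => h.elim⟩
    rintro u hu (rfl | huy)
    · exact hyW hu
    · exact hlab fun _ => ⟨u, .inl hu, hT _ _ huy⟩

/-- If the undecided argument `y` is the only undecided attacker of another one, then this
situation is found in the incomplete framework. -/
theorem Lab.possSole {I : IAF V} {S : Finset V} {D : V → Prop} {T : V → V → Prop}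
    {W : V → Prop} {x y : V} (h : Lab .co D T S W) (hA : ∀ u ∈ I.A, D u)
    (hD : ∀ u, D u → u ∈ I.A ∪ I.AQ) (hT : ∀ b a, (b, a) ∈ I.R → T b a)
    (hT' : ∀ b a, T b a → (b, a) ∈ I.R ∪ I.RQ) (hx : W x) (hy : W y)
    (hsole : ∀ b, W b → T b y → b = x) : PossSole I S x y := by
  obtain ⟨b, hb, hby⟩ := h.complete rfl y hy
  obtain rfl := hsole b hb hby
  refine ⟨hT' _ _ hby, W, h.good hD hT hT' ?_, h.check (fun u hu _ => hA u hu) hT hT', ?_⟩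
  · rintro u hu ⟨hub, huy⟩
    exact hub (hsole u hu (hT _ _ huy))
  · rintro u (rfl | rfl) <;> assumption

/-- If `W` fails to stay closed under having an attacker once `y` is taken out, some other member
`b` had `y` as its only undecided attacker. -/
theorem exists_possSole {σ : Semantics} {I : IAF V} {S : Finset V} {D : V → Prop}
    {T : V → V → Prop} {W : V → Prop} {y : V} (h : Lab σ D T S W) (hA : ∀ u ∈ I.A, D u)
    (hD : ∀ u, D u → u ∈ I.A ∪ I.AQ) (hT : ∀ b a, (b, a) ∈ I.R → T b a)
    (hT' : ∀ b a, T b a → (b, a) ∈ I.R ∪ I.RQ) (hy : W y)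
    (hn : ¬ (σ = .co → ∀ b, W b → b ≠ y → ∃ b', W b' ∧ b' ≠ y ∧ T b' b)) :
    σ = .co ∧ ∃ b, b ≠ y ∧ PossSole I S y b := by
  push Not at hn
  obtain ⟨rfl, b, hb, hby, hsole⟩ := hn
  refine ⟨rfl, b, hby, h.possSole hA hD hT hT' hy hb fun b' hb' hbb => ?_⟩
  by_contra hne
  exact hsole b' hb' hne hbb

/-! ### Building completions -/

/-- The attacks of a completion with undecided arguments `W`: uncertain attacks from `S` are
present if their target is neither in `S` nor in `W` nor in `Y`, and those within `W` if they
satisfy `P`. -/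
def buildAtt (I : IAF V) (S : Finset V) (W Y : V → Prop) (P : V → V → Prop) (b a : V) : Prop :=
  (b, a) ∈ I.R ∨ (b, a) ∈ I.RQ ∧ (b ∈ S ∧ a ∉ S ∧ ¬ W a ∧ ¬ Y a ∨ W b ∧ W a ∧ P b a)

/-- The arguments of a completion with undecided arguments `W`. -/
def buildArg (I : IAF V) (S : Finset V) (W : V → Prop) (u : V) : Prop := u ∈ I.A ∨ u ∈ S ∨ W u

theorem Good.completes {σ : Semantics} {I : IAF V} {S : Finset V} {X W Y : V → Prop}
    (h : Good σ I S X W) (hS : S ⊆ I.A ∪ I.AQ) (P : V → V → Prop) :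
    Completes I (buildArg I S W) (buildAtt I S W Y P) where
  certArg u hu := .inl hu
  possArg u hu := by
    rcases hu with hu | hu | hu
    · exact Finset.mem_union_left _ hu
    · exact hS hu
    · exact h.arg u hu
  certAtt b a h := .inl h
  possAtt b a h := Finset.mem_union.2 (h.imp id And.left)

/-- Every argument to be attacked by `S` gets its possible attack from `S`; no uncertain attack is
switched on inside `S` or between `S` and `W`, and the certain ones there are excluded by
hypothesis. The relation `P` thins out the uncertain attacks within `W`; under complete semantics
each member must keep one attacker. -/
theorem Good.lab {σ : Semantics} {I : IAF V} {S : Finset V} {X W Y : V → Prop}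
    {P : V → V → Prop} (h : Good σ I S X W) (hc : Check I S Y W)
    (hP : σ = .co → ∀ u, W u → ∃ b, W b ∧ (b, u) ∈ I.R ∪ I.RQ ∧ P b u) (hY : ∀ u, Y u → ¬ W u)
    (hYS : ∀ u, Y u → u ∉ S) :
    Lab σ (fun u => buildArg I S W u ∧ ¬ Y u) (buildAtt I S W Y P) S W where
  sub u hu := ⟨.inr (.inl hu), fun h => hYS u h hu⟩
  undec u hu := ⟨⟨.inr (.inr hu), fun h => hY u h hu⟩, h.notMem u hu⟩
  free s hs s' hs' hT := by
    have := hc.free s hs s' hs'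
    have := h.notMem s'
    unfold buildAtt at hT
    tauto
  out u hu huS huW := by
    obtain ⟨s, hs, hsu⟩ := hc.out u (by unfold buildArg at hu; tauto) huS hu.2 huW
    rw [Finset.mem_union] at hsu
    exact ⟨s, hs, hsu.imp id fun hQ => ⟨hQ, .inl ⟨hs, huS, huW, hu.2⟩⟩⟩
  notTo u hu s hs hT := by
    have := h.notTo u hu s hs
    have := h.notMem s
    unfold buildAtt at hT
    tauto
  notFrom u hu s hs hT := by
    have := h.notFrom u hu s hs
    have := h.notMem s
    have := h.notMem u hu
    unfold buildAtt at hT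
    tauto
  stable := h.stable
  complete hσ u hu := by
    obtain ⟨b, hb, hbu, hPb⟩ := hP hσ u hu
    rw [Finset.mem_union] at hbu
    exact ⟨b, hb, hbu.imp id fun hQ => ⟨hQ, .inr ⟨hb, hu, hPb⟩⟩⟩

theorem PossExt.build {σ : Semantics} {I : IAF V} {S : Finset V} {Z : V → Prop}
    (h : Verif σ I S (fun _ => False) (fun _ => False) Z) (hS : S ⊆ I.A ∪ I.AQ) :
    ∃ D T W, Completes I D T ∧ Lab σ D T S W ∧ ∀ u, Z u → W u := by
  obtain ⟨W, hg, hc, hZ⟩ := h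
  refine ⟨_, _, W, hg.completes hS (Y := fun _ => False) fun _ _ => True, ?_, hZ⟩
  have := hg.lab hc (P := fun _ _ => True) (by simpa using hg.complete) (by simp) (by simp)
  simpa using this

theorem PossSole.build {I : IAF V} {S : Finset V} {x y : V} (h : PossSole I S x y)
    (hS : S ⊆ I.A ∪ I.AQ) :
    ∃ D T W, Completes I D T ∧ Lab .co D T S W ∧ W x ∧ W y ∧ T x y ∧
      ∀ b, W b → T b y → b = x := by
  obtain ⟨hxy, W, hg, hc, hZ⟩ := h
  have hx := hZ x (.inl rfl)
  have hy := hZ y (.inr rfl)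
  -- This `P` switches off every uncertain attack on `y` from `W` except the one from `x`. Certain
  -- attacks on `y` from other members of `W` are ruled out by the avoided set.
  refine ⟨_, _, W, hg.completes hS (Y := fun _ => False) fun b a => a = y → b = x, ?_, hx, hy,
    ?_, ?_⟩
  · have := hg.lab hc (P := fun b a => a = y → b = x) ?_ (by simp) (by simp)
    · simpa using this
    · intro hσ u hu
      by_cases huy : u = y
      · subst huy; exact ⟨x, hx, hxy, fun _ => rfl⟩
      · obtain ⟨b, hb, hbu⟩ := hg.complete hσ u hu
        exact ⟨b, hb, hbu, fun h => (huy h).elim⟩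
  · exact (Finset.mem_union.1 hxy).imp id fun h => ⟨h, .inr ⟨hx, hy, fun _ => rfl⟩⟩
  · intro b hb hby
    have h₁ := hg.avoid b hb
    have h₂ := hg.notMem b hb
    unfold buildAtt at hby
    tauto

/-- Without `y` the set `W` shows that `S` is an extension. With `y`, which `S` does not attack, `y`
is forced to be undecided. This is impossible under stable semantics, or if `y` attacks `S`, or,
under complete semantics, if all attackers of `y` are attacked by `S`. -/
theorem PossBlock.build {σ : Semantics} {I : IAF V} {S : Finset V} {y : V}
    (h : PossBlock σ I S y) (hS : S ⊆ I.A ∪ I.AQ) (hyU : y ∈ I.A ∪ I.AQ) :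
    ∃ D T, Completes I D T ∧ D y ∧ Ext σ (fun u => D u ∧ y ≠ u) T S ∧ (∀ s ∈ S, ¬ T s y) ∧
      ¬ Ext σ D T S := by
  obtain ⟨hyS, hyR, h⟩ := h
  have hcompl : ∀ (X W : V → Prop) (Q : V → V → Prop), Good σ I S X W →
      (∀ b a, Q b a → (b, a) ∈ I.R ∪ I.RQ) →
      Completes I (fun u => buildArg I S W u ∨ u = y)
        (fun b a => buildAtt I S W (fun u => u = y) (fun _ _ => True) b a ∨ Q b a) := by
    intro X W Q hg hQ
    have := hg.completes hS (Y := fun u => u = y) fun _ _ => True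
    refine ⟨fun u hu => .inl (this.certArg u hu), ?_, fun b a h => .inl (this.certAtt b a h), ?_⟩
    · rintro u (hu | rfl)
      · exact this.possArg u hu
      · exact hyU
    · rintro b a (h | h)
      · exact this.possAtt b a h
      · exact hQ b a h
  have hlab : ∀ (X W : V → Prop), Good σ I S X W → Check I S (fun u => u = y) W → ¬ W y →
      Lab σ (fun u => (buildArg I S W u ∨ u = y) ∧ y ≠ u)
        (buildAtt I S W (fun u => u = y) fun _ _ => True) S W := by
    intro X W hg hc hyW
    have := hg.lab hc (P := fun _ _ => True) (by simpa using hg.complete)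
      (by rintro u rfl; exact hyW) (by rintro u rfl; exact hyS)
    convert this using 2 with u
    grind
  have hyT : ∀ W : V → Prop, ¬ W y → ∀ s ∈ S,
      ¬ buildAtt I S W (fun u => u = y) (fun _ _ => True) s y := by
    intro W hyW s hs
    have := hyR s hs
    unfold buildAtt
    tauto
  rcases h with ⟨hcase, W, hg, hc, -⟩ | ⟨rfl, hyy, W, hg, hc, -⟩
  · have hyW : ¬ W y := fun h => hg.avoid y h rfl
    have hl := hlab _ W hg hc hyW
    have hT := hyT W hyW
    -- All possible attacks from `y` on `S` are switched on; they do not matter while `y` is absent.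
    let Q : V → V → Prop := fun b a => b = y ∧ a ∈ S ∧ (b, a) ∈ I.R ∪ I.RQ
    refine ⟨_, _, hcompl _ W Q hg fun b a h => h.2.2, .inr rfl, ⟨W, ?_⟩, ?_, ?_⟩
    · have hQ : ∀ b a, Q b a → b = y ∧ a ∈ S := fun b a h => ⟨h.1, h.2.1⟩
      refine ⟨hl.sub, hl.undec, ?_, ?_, ?_, ?_, hl.stable, ?_⟩
      · rintro s hs s' hs' (h | h)
        · exact hl.free s hs s' hs' h
        · exact hyS (h.1 ▸ hs)
      · intro u hu huS huW
        obtain ⟨s, hs, hsu⟩ := hl.out u hu huS huW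
        exact ⟨s, hs, .inl hsu⟩
      · rintro u hu s hs (h | h)
        · exact hl.notTo u hu s hs h
        · exact hyS (h.1 ▸ hs)
      · rintro u hu s hs (h | h)
        · exact hl.notFrom u hu s hs h
        · exact hyW (h.1 ▸ hu)
      · intro hσ u hu
        obtain ⟨b, hb, hbu⟩ := hl.complete hσ u hu
        exact ⟨b, hb, .inl hbu⟩
    · rintro s hs (h | h)
      · exact hT s hs h
      · exact hyS h.2.1
    · rintro ⟨W', hW'⟩
      have hyW' : W' y := by
        by_contra hyW'
        obtain ⟨s, hs, h | h⟩ := hW'.out y (.inr rfl) hyS hyW'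
        · exact hT s hs h
        · exact hyS h.2.1
      rcases hcase with hσ | ⟨s, hs, hys⟩
      · exact hW'.stable hσ y hyW'
      · exact hW'.notFrom y hyW' s hs (.inr ⟨rfl, hs, hys⟩)
  · have hyW : ¬ W y := fun h => hg.avoid y h (.inl rfl)
    have hl := hlab _ W hg hc hyW
    have hT := hyT W hyW
    refine ⟨_, _, ⟨(hcompl _ W (fun _ _ => False) hg (by simp)).certArg,
      (hcompl _ W (fun _ _ => False) hg (by simp)).possArg,
      fun b a h => .inl h, fun b a h => (hcompl _ W (fun _ _ => False) hg (by simp)).possAtt b a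
        (.inl h)⟩, .inr rfl, ⟨W, hl⟩, hT, ?_⟩
    rintro ⟨W', hW'⟩
    have hyW' : W' y := by
      by_contra hyW'
      obtain ⟨s, hs, h⟩ := hW'.out y (.inr rfl) hyS hyW'
      exact hT s hs h
    -- An undecided attacker `b` of `y` would be outside `S` and `W` and different from `y`, but
    -- then it is attacked by `S`.
    obtain ⟨b, hb, hby⟩ := hW'.complete rfl y hyW'
    have hbS := (hW'.undec b hb).2
    have hbW : ¬ W b := by
      intro hbW
      have := hg.avoid b hbW
      unfold buildAtt at hby
      tauto
    have hb' : b ≠ y := by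
      rintro rfl
      unfold buildAtt at hby
      tauto
    obtain ⟨s, hs, hsb⟩ := hl.out b ⟨(hW'.undec b hb).1, hb'.symm⟩ hbS hbW
    exact hW'.notTo b hb s hs hsb

end ArgFW

namespace ArgFW

variable {V : Type} [DecidableEq V]

/-! ### Characterization of relevance -/

/-- Criterion for the relevance of adding an element. -/
def AddCrit (σ : Semantics) (I : IAF V) (S : Finset V) : V ⊕ V × V → Prop
  | .inl a => a ∈ S ∧ PossExt σ I S ∨ a ∉ S ∧ σ = .co ∧ ∃ b, b ≠ a ∧ PossSole I S a b
  | .inr r => r.1 ∈ S ∧ PossBlock σ I S r.2 ∨ r.1 ∉ S ∧ r.2 ∉ S ∧ σ = .co ∧ PossSole I S r.1 r.2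

/-- Criterion for the relevance of removing an element. -/
def RemCrit (σ : Semantics) (I : IAF V) (S : Finset V) : V ⊕ V × V → Prop
  | .inl a => PossBlock σ I S a
  | .inr r => r.1 ∈ S ∧ r.2 ∈ S ∧ PossExt σ I S ∨
      r.1 ∈ S ∧ r.2 ∉ S ∧ σ = .co ∧ (∃ b, b ≠ r.2 ∧ PossSole I S r.2 b) ∨
      r.1 ∉ S ∧ r.2 ∈ S ∧ PossUndec σ I S r.1

theorem extWith_inl {V : Type} {σ : Semantics} {D : V → Prop} {T : V → V → Prop} {S : Finset V} {a : V} :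
    ExtWith σ D T S (.inl a) ↔ Ext σ D T S := by
  simp [ExtWith]

theorem extWithout_inl {V : Type} {σ : Semantics} {D : V → Prop} {T : V → V → Prop} {S : Finset V} {a : V} :
    ExtWithout σ D T S (.inl a) ↔ Ext σ (fun u => D u ∧ a ≠ u) T S := by
  simp [ExtWithout]

theorem extWith_inr {V : Type} {σ : Semantics} {D : V → Prop} {T : V → V → Prop} {S : Finset V} {x y : V} :
    ExtWith σ D T S (.inr (x, y)) ↔ Ext σ D (fun b a => T b a ∨ x = b ∧ y = a) S := by
  simp [ExtWith]

theorem extWithout_inr {V : Type} {σ : Semantics} {D : V → Prop} {T : V → V → Prop} {S : Finset V}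
    {x y : V} :
    ExtWithout σ D T S (.inr (x, y)) ↔ Ext σ D (fun b a => T b a ∧ ¬ (x = b ∧ y = a)) S := by
  simp [ExtWithout]

/-- Removing an undecided argument that is not the sole undecided attacker of another one. -/
theorem Lab.removeArg {V : Type} {σ : Semantics} {D : V → Prop} {T : V → V → Prop} {S : Finset V}
    {W : V → Prop} {a : V} (h : Lab σ D T S W) (haS : a ∉ S)
    (hn : σ = .co → ∀ b, W b → b ≠ a → ∃ b', W b' ∧ b' ≠ a ∧ T b' b) :
    Ext σ (fun u => D u ∧ a ≠ u) T S := by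
  refine ⟨fun u => W u ∧ u ≠ a, ⟨fun u hu => ⟨h.sub u hu, fun h => haS (h ▸ hu)⟩,
    fun u hu => ⟨⟨(h.undec u hu.1).1, hu.2.symm⟩, (h.undec u hu.1).2⟩, h.free, ?_,
    fun u hu => h.notTo u hu.1, fun u hu => h.notFrom u hu.1, fun hσ u hu => h.stable hσ u hu.1,
    ?_⟩⟩
  · intro u hu huS huW
    exact h.out u hu.1 huS fun hW => huW ⟨hW, hu.2.symm⟩
  · intro hσ u hu
    obtain ⟨b, hb, hba, hbu⟩ := hn hσ u hu.1 hu.2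
    exact ⟨b, ⟨hb, hba⟩, hbu⟩

/-- A member of `S` is indispensable. An argument outside `S` can be needed only as the last
undecided attacker of another undecided argument, which otherwise would be defended without being in
`S`. -/
theorem addition_inl_iff {I : IAF V} {S : Finset V} (hS : S ⊆ I.A ∪ I.AQ) {a : V}
    (ha : a ∈ I.AQ) (σ : Semantics) :
    (∃ D T, Completes I D T ∧ D a ∧ Ext σ D T S ∧ ¬ Ext σ (fun u => D u ∧ a ≠ u) T S) ↔
      AddCrit σ I S (.inl a) := by
  have haA : a ∉ I.A := fun h => Finset.disjoint_left.1 I.disjoint_args h ha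
  constructor
  · rintro ⟨D, T, hC, hDa, ⟨W, hW⟩, hn⟩
    by_cases haS : a ∈ S
    · exact .inl ⟨haS, W, hW.good hC.possArg hC.certAtt hC.possAtt (by simp),
        hW.check (fun u hu _ => hC.certArg u hu) hC.certAtt hC.possAtt, by simp⟩
    · refine .inr ⟨haS, ?_⟩
      have h' := fun h => hn (hW.removeArg haS h)
      have haW : W a := by
        by_contra haW
        refine h' fun hσ b hb hba => ?_
        obtain ⟨b', hb', hbb⟩ := hW.complete hσ b hb
        exact ⟨b', hb', fun h => haW (h ▸ hb'), hbb⟩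
      exact exists_possSole hW hC.certArg hC.possArg hC.certAtt hC.possAtt haW h'
  · rintro (⟨haS, h⟩ | ⟨haS, rfl, b, hba, h⟩)
    · obtain ⟨D, T, W, hC, hW, -⟩ := PossExt.build h hS
      exact ⟨D, T, hC, hW.sub a haS, ⟨W, hW⟩, fun ⟨W', hW'⟩ => (hW'.sub a haS).2 rfl⟩
    · obtain ⟨D, T, W, hC, hW, hx, hy, hT, hsole⟩ := h.build hS
      refine ⟨D, T, hC, (hW.undec a hx).1, ⟨W, hW⟩, ?_⟩
      rintro ⟨W', hW'⟩
      have hbS := (hW.undec b hy).2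
      have hb' : W' b := by
        by_contra hb'
        obtain ⟨s, hs, hsb⟩ := hW'.out b ⟨(hW.undec b hy).1, hba.symm⟩ hbS hb'
        exact hW.notTo b hy s hs hsb
      -- Without `a` the argument `b` is still undecided and needs an undecided attacker `c`. As `c
      -- ≠ a`, it was not in `W`, so `S` attacks it.
      obtain ⟨c, hc, hcb⟩ := hW'.complete rfl b hb'
      have hcD := (hW'.undec c hc)
      obtain ⟨s, hs, hsc⟩ := hW.out c hcD.1.1 hcD.2 fun hcW => hcD.1.2 (hsole c hcW hcb).symm
      exact hW'.notTo c hc s hs hsc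

theorem removal_inl_iff {I : IAF V} {S : Finset V} (hS : S ⊆ I.A ∪ I.AQ) {a : V}
    (ha : a ∈ I.AQ) (σ : Semantics) :
    (∃ D T, Completes I D T ∧ D a ∧ Ext σ (fun u => D u ∧ a ≠ u) T S ∧ ¬ Ext σ D T S) ↔
      RemCrit σ I S (.inl a) := by
  constructor
  · rintro ⟨D, T, hC, hDa, ⟨W, hW⟩, hn⟩
    exact hW.possBlock hC.certArg hC.possArg hC.certAtt hC.possAtt hDa hn
  · intro h
    obtain ⟨D, T, hC, hDa, he, -, hn⟩ := h.build hS (Finset.mem_union_right _ ha)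
    exact ⟨D, T, hC, hDa, he, hn⟩

/-- An attack from `S` helps only by defeating a `y` that would block `S`. An attack between
undecided arguments helps only as the sole undecided attack on its target. All other attacks can be
dropped with the same labelling. -/
theorem addition_inr_iff {I : IAF V} {S : Finset V} (hS : S ⊆ I.A ∪ I.AQ) {x y : V}
    (hxy : (x, y) ∈ I.RQ) (σ : Semantics) :
    (∃ D T, Completes I D T ∧ (D x ∧ D y) ∧ Ext σ D (fun b a => T b a ∨ x = b ∧ y = a) S ∧
      ¬ Ext σ D (fun b a => T b a ∧ ¬ (x = b ∧ y = a)) S) ↔ AddCrit σ I S (.inr (x, y)) := by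
  have hR : (x, y) ∉ I.R := fun h => Finset.disjoint_left.1 I.disjoint_atts h hxy
  have hyU : y ∈ I.A ∪ I.AQ := (Finset.mem_product.1 (I.RQ_subset hxy)).2
  constructor
  · rintro ⟨D, T, hC, ⟨hDx, hDy⟩, ⟨W, hW⟩, hn⟩
    have hT₁ : ∀ b a, (b, a) ∈ I.R → T b a ∧ ¬ (x = b ∧ y = a) := by
      intro b a h
      refine ⟨hC.certAtt b a h, ?_⟩
      rintro ⟨rfl, rfl⟩
      exact hR h
    have hT₂ : ∀ b a, (T b a ∨ x = b ∧ y = a) → (b, a) ∈ I.R ∪ I.RQ := by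
      rintro b a (h | ⟨rfl, rfl⟩)
      · exact hC.possAtt b a h
      · exact Finset.mem_union_right _ hxy
    have hmono : ∀ u, W u → (∀ b, W b → (T b u ∨ x = b ∧ y = u) → ¬ (x = b ∧ y = u)) →
        (∃ b, W b ∧ (T b u ∨ x = b ∧ y = u)) → ∃ b, W b ∧ T b u ∧ ¬ (x = b ∧ y = u) := by
      rintro u - h ⟨b, hb, hbu⟩
      exact ⟨b, hb, by have := h b hb hbu; tauto, h b hb hbu⟩
    have hsame : (∀ u, D u → u ∉ S → ¬ W u → ∃ s ∈ S, T s u ∧ ¬ (x = s ∧ y = u)) →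
        (σ = .co → ∀ u, W u → ∃ b, W b ∧ T b u ∧ ¬ (x = b ∧ y = u)) → False := by
      intro h₁ h₂
      refine hn ⟨W, ⟨hW.sub, hW.undec, fun s hs s' hs' h => hW.free s hs s' hs' (.inl h.1), h₁,
        fun u hu s hs h => hW.notTo u hu s hs (.inl h.1),
        fun u hu s hs h => hW.notFrom u hu s hs (.inl h.1), hW.stable, h₂⟩⟩
    by_cases hxS : x ∈ S
    · have hyS : y ∉ S := fun hyS => hW.free x hxS y hyS (.inr ⟨rfl, rfl⟩)
      have hyW : ¬ W y := fun hyW => hW.notTo y hyW x hxS (.inr ⟨rfl, rfl⟩)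
      refine .inl ⟨hxS, ?_⟩
      -- The attack concerns no argument other than its target, so once `y` is absent `W` remains a
      -- labelling without the attack.
      have hl : Lab σ (fun u => D u ∧ y ≠ u) (fun b a => T b a ∧ ¬ (x = b ∧ y = a)) S W := by
        refine ⟨fun u hu => ⟨hW.sub u hu, fun h => hyS (h ▸ hu)⟩,
          fun u hu => ⟨⟨(hW.undec u hu).1, fun h => hyW (h ▸ hu)⟩, (hW.undec u hu).2⟩,
          fun s hs s' hs' h => hW.free s hs s' hs' (.inl h.1), ?_,
          fun u hu s hs h => hW.notTo u hu s hs (.inl h.1),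
          fun u hu s hs h => hW.notFrom u hu s hs (.inl h.1), hW.stable, ?_⟩
        · intro u hu huS huW
          obtain ⟨s, hs, hsu⟩ := hW.out u hu.1 huS huW
          have := hu.2
          exact ⟨s, hs, by tauto⟩
        · intro hσ u hu
          refine hmono u hu ?_ (hW.complete hσ u hu)
          rintro b hb - ⟨rfl, rfl⟩
          exact hyW hu
      exact hl.possBlock hC.certArg hC.possArg hT₁ (fun b a h => hC.possAtt b a h.1) hDy hn
    · have hout : ∀ u, D u → u ∉ S → ¬ W u → ∃ s ∈ S, T s u ∧ ¬ (x = s ∧ y = u) := by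
        intro u hu huS huW
        obtain ⟨s, hs, hsu⟩ := hW.out u hu huS huW
        have : x ≠ s := fun h => hxS (h ▸ hs)
        exact ⟨s, hs, by tauto⟩
      have h' := hsame hout
      have hsole : σ = .co ∧ W y ∧ ∀ b, W b → (T b y ∨ x = b ∧ y = y) → b = x := by
        by_contra hne
        refine h' fun hσ u hu => ?_
        by_cases huy : u = y
        · subst huy
          push Not at hne
          obtain ⟨b, hb, hby, hbx⟩ := hne hσ hu
          refine ⟨b, hb, ?_, fun h => hbx h.1.symm⟩
          exact hby.resolve_right fun h => hbx h.1.symm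
        · exact hmono u hu (fun b _ _ h => huy h.2.symm) (hW.complete hσ u hu)
      obtain ⟨rfl, hyW, hs⟩ := hsole
      have hxW : W x := by
        obtain ⟨b, hb, hby⟩ := hW.complete rfl y hyW
        exact hs b hb (by simpa using hby) ▸ hb
      exact .inr ⟨hxS, (hW.undec y hyW).2, rfl, hW.possSole hC.certArg hC.possArg
        (fun b a h => .inl (hT₁ b a h).1) hT₂ hxW hyW (by simpa using hs)⟩
  · rintro (⟨hxS, h⟩ | ⟨hxS, hyS, rfl, h⟩)
    · obtain ⟨D, T, hC, hDy, ⟨W, hW⟩, hyT, hn⟩ := h.build hS hyU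
      have hyS : y ∉ S := h.1
      change x ∈ S at hxS
      change y ∉ S at hyS
      refine ⟨D, T, hC, ⟨(hW.sub x hxS).1, hDy⟩, ⟨W, ⟨fun u hu => (hW.sub u hu).1,
        fun u hu => ⟨(hW.undec u hu).1.1, (hW.undec u hu).2⟩, ?_, ?_, ?_, ?_, hW.stable, ?_⟩⟩, ?_⟩
      · rintro s hs s' hs' (h | ⟨rfl, rfl⟩)
        · exact hW.free s hs s' hs' h
        · exact hyS hs'
      · intro u hu huS huW
        by_cases huy : y = u
        · exact ⟨x, hxS, .inr ⟨rfl, huy⟩⟩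
        · obtain ⟨s, hs, hsu⟩ := hW.out u ⟨hu, huy⟩ huS huW
          exact ⟨s, hs, .inl hsu⟩
      · rintro u hu s hs (h | ⟨rfl, rfl⟩)
        · exact hW.notTo u hu s hs h
        · exact (hW.undec _ hu).1.2 rfl
      · rintro u hu s hs (h | ⟨rfl, rfl⟩)
        · exact hW.notFrom u hu s hs h
        · exact hyS hs
      · intro hσ u hu
        obtain ⟨b, hb, hbu⟩ := hW.complete hσ u hu
        exact ⟨b, hb, .inl hbu⟩
      -- In the completion built from `PossBlock` nothing in `S` attacks `y`, so deleting the attack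
      -- from `x` changes nothing.
      · have : (fun b a => T b a ∧ ¬ (x = b ∧ y = a)) = T := by
          funext b a
          refine propext ⟨And.left, fun h => ⟨h, ?_⟩⟩
          rintro ⟨rfl, rfl⟩
          exact hyT x hxS h
        rwa [this]
    · obtain ⟨D, T, W, hC, hW, hx, hy, hT, hsole⟩ := h.build hS
      change x ∉ S at hxS
      change W x at hx
      change W y at hy
      change T x y at hT
      refine ⟨D, T, hC, ⟨(hW.undec x hx).1, (hW.undec y hy).1⟩, ?_, ?_⟩
      · have : (fun b a => T b a ∨ (x = b ∧ y = a)) = T := by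
          funext b a
          refine propext ⟨fun h => h.elim id ?_, .inl⟩
          rintro ⟨rfl, rfl⟩
          exact hT
        rw [this]
        exact ⟨W, hW⟩
      · rintro ⟨W', hW'⟩
        have hy' : W' y := by
          by_contra hy'
          obtain ⟨s, hs, hsy⟩ := hW'.out y (hW.undec y hy).1 (hW.undec y hy).2 hy'
          exact hW.notTo y hy s hs hsy.1
        obtain ⟨c, hc, hcy⟩ := hW'.complete rfl y hy'
        have hcD := hW'.undec c hc
        obtain ⟨s, hs, hsc⟩ := hW.out c hcD.1 hcD.2 fun hcW =>
          hcy.2 ⟨(hsole c hcW hcy.1).symm, rfl⟩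
        exact hW'.notTo c hc s hs ⟨hsc, fun h => hxS (h.1 ▸ hs)⟩

/-- The presence of the attack `(x, y)` harms `S` in three ways: as a conflict in `S`; by turning an
undecided `y` that is the sole undecided attacker of some `b` into an attacked one, which leaves `b`
defended; or as an attack on `S` from an undecided `x`. -/
theorem removal_inr_iff {I : IAF V} {S : Finset V} (hS : S ⊆ I.A ∪ I.AQ) {x y : V}
    (hxy : (x, y) ∈ I.RQ) (σ : Semantics) :
    (∃ D T, Completes I D T ∧ (D x ∧ D y) ∧
      Ext σ D (fun b a => T b a ∧ ¬ (x = b ∧ y = a)) S ∧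
      ¬ Ext σ D (fun b a => T b a ∨ x = b ∧ y = a) S) ↔ RemCrit σ I S (.inr (x, y)) := by
  have hR : (x, y) ∉ I.R := fun h => Finset.disjoint_left.1 I.disjoint_atts h hxy
  constructor
  · rintro ⟨D, T, hC, ⟨hDx, hDy⟩, ⟨W, hW⟩, hn⟩
    have hT₁ : ∀ b a, (b, a) ∈ I.R → T b a ∧ ¬ (x = b ∧ y = a) := by
      intro b a h
      refine ⟨hC.certAtt b a h, ?_⟩
      rintro ⟨rfl, rfl⟩
      exact hR h
    have hT₂ : ∀ b a, T b a ∧ ¬ (x = b ∧ y = a) → (b, a) ∈ I.R ∪ I.RQ :=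
      fun b a h => hC.possAtt b a h.1
    have hc : Check I S (fun _ => False) W := hW.check (fun u hu _ => hC.certArg u hu) hT₁ hT₂
    have hg : Good σ I S (fun _ => False) W := hW.good hC.possArg hT₁ hT₂ (by simp)
    -- The common argument of all cases: no `W' ⊆ W` can be a labelling in the presence of the
    -- attack. It is applied to `W` itself and to `W` without `y`.
    have hW' : ∀ W' : V → Prop, (∀ u, W' u → W u) →
        (∀ u, D u → u ∉ S → ¬ W' u → W u → ∃ s ∈ S, T s u ∨ x = s ∧ y = u) →
        ¬ (x ∈ S ∧ y ∈ S) → (x ∈ S → ¬ W' y) → (y ∈ S → ¬ W' x) →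
        (σ = .co → ∀ u, W' u → ∃ b, W' b ∧ (T b u ∧ ¬ (x = b ∧ y = u))) → False := by
      intro W' hsub hout hxyS hyW' hxW' hco
      refine hn ⟨W', ⟨hW.sub, fun u hu => hW.undec u (hsub u hu), ?_, ?_, ?_, ?_,
        fun hσ u hu => hW.stable hσ u (hsub u hu), ?_⟩⟩
      · intro s hs s' hs' h
        by_cases he : x = s ∧ y = s'
        · obtain ⟨rfl, rfl⟩ := he
          exact hxyS ⟨hs, hs'⟩
        · exact h.elim (fun h => hW.free s hs s' hs' ⟨h, he⟩) he
      · intro u hu huS huW'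
        by_cases huW : W u
        · exact hout u hu huS huW' huW
        · obtain ⟨s, hs, hsu⟩ := hW.out u hu huS huW
          exact ⟨s, hs, .inl hsu.1⟩
      · intro u hu s hs h
        by_cases he : x = s ∧ y = u
        · obtain ⟨rfl, rfl⟩ := he
          exact hyW' hs hu
        · exact h.elim (fun h => hW.notTo u (hsub u hu) s hs ⟨h, he⟩) he
      · intro u hu s hs h
        by_cases he : x = u ∧ y = s
        · obtain ⟨rfl, rfl⟩ := he
          exact hxW' hs hu
        · exact h.elim (fun h => hW.notFrom u (hsub u hu) s hs ⟨h, he⟩) he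
      · intro hσ u hu
        obtain ⟨b, hb, hbu⟩ := hco hσ u hu
        exact ⟨b, hb, .inl hbu.1⟩
    have hsame := hW' W (fun u => id) (fun u _ _ h h' => (h h').elim)
    by_cases hxS : x ∈ S <;> by_cases hyS : y ∈ S
    · exact .inl ⟨hxS, hyS, W, hg, hc, by simp⟩
    · refine .inr (.inl ⟨hxS, hyS, ?_⟩)
      have hyW : W y := by
        by_contra hyW
        exact hsame (fun h => hyS h.2) (fun _ => hyW) (fun h => (hyS h).elim) hW.complete
      refine exists_possSole hW hC.certArg hC.possArg hT₁ hT₂ hyW fun h => ?_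
      refine hW' (fun u => W u ∧ u ≠ y) (fun u hu => hu.1) ?_ (fun h => hyS h.2)
        (fun _ h => h.2 rfl) (fun h => (hyS h).elim) ?_
      · intro u hu huS huW' huW
        refine ⟨x, hxS, .inr ⟨rfl, ?_⟩⟩
        by_contra hne
        exact huW' ⟨huW, fun h => hne h.symm⟩
      · intro hσ u hu
        obtain ⟨b, hb, hby, hbu⟩ := h hσ u hu.1 hu.2
        exact ⟨b, ⟨hb, hby⟩, hbu⟩
    · refine .inr (.inr ⟨hxS, hyS, W, hg, hc, ?_⟩)
      rintro u rfl
      by_contra hxW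
      exact hsame (fun h => hxS h.1) (fun h => (hxS h).elim) (fun _ => hxW) hW.complete
    · exact (hsame (fun h => hxS h.1) (fun h => (hxS h).elim) (fun h => (hyS h).elim)
        hW.complete).elim
  · have hrem : ∀ T : V → V → Prop, ¬ T x y → (fun b a => T b a ∧ ¬ (x = b ∧ y = a)) = T := by
      intro T hT
      funext b a
      refine propext ⟨And.left, fun h => ⟨h, ?_⟩⟩
      rintro ⟨rfl, rfl⟩
      exact hT h
    rintro (⟨hxS, hyS, h⟩ | ⟨hxS, hyS, rfl, b, hby, h⟩ | ⟨hxS, hyS, h⟩)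
    · change x ∈ S at hxS
      change y ∈ S at hyS
      obtain ⟨D, T, W, hC, hW, -⟩ := PossExt.build h hS
      refine ⟨D, T, hC, ⟨hW.sub x hxS, hW.sub y hyS⟩, ?_, ?_⟩
      · rw [hrem T (hW.free x hxS y hyS)]
        exact ⟨W, hW⟩
      · rintro ⟨W', hW'⟩
        exact hW'.free x hxS y hyS (.inr ⟨rfl, rfl⟩)
    · change x ∈ S at hxS
      change b ≠ y at hby
      obtain ⟨D, T, W, hC, hW, hy, hb, hT, hsole⟩ := h.build hS
      change W y at hy
      refine ⟨D, T, hC, ⟨hW.sub x hxS, (hW.undec y hy).1⟩, ?_, ?_⟩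
      · rw [hrem T (hW.notTo y hy x hxS)]
        exact ⟨W, hW⟩
      · rintro ⟨W', hW'⟩
        have hb' : W' b := by
          by_contra hb'
          obtain ⟨s, hs, hsb⟩ := hW'.out b (hW.undec b hb).1 (hW.undec b hb).2 hb'
          exact hW.notTo b hb s hs (hsb.resolve_right fun h => hby h.2.symm)
        obtain ⟨c, hc, hcb⟩ := hW'.complete rfl b hb'
        have hcb' : T c b := hcb.resolve_right fun h => hby h.2.symm
        have hcy : c ≠ y := by
          rintro rfl
          exact hW'.notTo _ hc x hxS (.inr ⟨rfl, rfl⟩)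
        obtain ⟨s, hs, hsc⟩ := hW.out c (hW'.undec c hc).1 (hW'.undec c hc).2 fun hcW =>
          hcy (hsole c hcW hcb')
        exact hW'.notTo c hc s hs (.inl hsc)
    · change y ∈ S at hyS
      change x ∉ S at hxS
      obtain ⟨D, T, W, hC, hW, hZ⟩ := PossExt.build h hS
      have hx : W x := hZ x rfl
      refine ⟨D, T, hC, ⟨(hW.undec x hx).1, hW.sub y hyS⟩, ?_, ?_⟩
      · rw [hrem T (hW.notFrom x hx y hyS)]
        exact ⟨W, hW⟩
      · rintro ⟨W', hW'⟩
        have hx' : ¬ W' x := fun hx' => hW'.notFrom x hx' y hyS (.inr ⟨rfl, rfl⟩)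
        obtain ⟨s, hs, hsx⟩ := hW'.out x (hW.undec x hx).1 hxS hx'
        exact hW.notTo x hx s hs (hsx.resolve_right fun h => hxS (h.1 ▸ hs))

theorem relevant_true_iff {I : IAF V} {S : Finset V} (hS : S ⊆ I.A ∪ I.AQ) {e : V ⊕ V × V}
    (he : e ∈ I.uncertain) (σ : Semantics) (c : Act) :
    Relevant ⟨σ, true⟩ I S c e ↔
      match c with
      | .addition => AddCrit σ I S e
      | .removal => RemCrit σ I S e := by
  rw [relevant_iff he]
  rcases e with a | ⟨x, y⟩
  · have ha : a ∈ I.AQ := by simpa [IAF.uncertain] using he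
    simp only [extWith_inl, extWithout_inl, Pres]
    rcases c with _ | _
    · exact addition_inl_iff hS ha σ
    · exact removal_inl_iff hS ha σ
  · have hxy : (x, y) ∈ I.RQ := by simpa [IAF.uncertain] using he
    simp only [extWith_inr, extWithout_inr, Pres]
    rcases c with _ | _
    · exact addition_inr_iff hS hxy σ
    · exact removal_inr_iff hS hxy σ

end ArgFW

namespace ArgFW

/-! ### The largest set of undecided arguments -/

section Iterate

variable {V : Type} [DecidableEq V]

/-- One step of the descending iteration towards the largest good set. -/
def goodStep (σ : Semantics) (I : IAF V) (S : Finset V) (X W : V → Prop) (u : V) : Prop :=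
  (u ∈ I.A ∪ I.AQ ∧ u ∉ S ∧ ∀ s ∈ S, (s, u) ∉ I.R ∧ (u, s) ∉ I.R) ∧ ¬ X u ∧
    σ ≠ .st ∧ (σ = .co → ∃ b, W b ∧ (b, u) ∈ I.R ∪ I.RQ)

/-- Good sets are the post-fixed points of a monotone operator, so there is a largest one, obtained
by iteration from the top. -/
theorem good_iff {σ : Semantics} {I : IAF V} {S : Finset V} {X W : V → Prop} :
    Good σ I S X W ↔ W ≤ goodStep σ I S X W := by
  constructor
  · intro h u hu
    exact ⟨⟨h.arg u hu, h.notMem u hu, fun s hs => ⟨h.notTo u hu s hs, h.notFrom u hu s hs⟩⟩,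
      h.avoid u hu, fun hσ => h.stable hσ u hu, fun hσ => h.complete hσ u hu⟩
  · intro h
    exact ⟨fun u hu => (h u hu).1.1, fun u hu => (h u hu).1.2.1,
      fun u hu s hs => ((h u hu).1.2.2 s hs).1, fun u hu s hs => ((h u hu).1.2.2 s hs).2,
      fun u hu => (h u hu).2.1, fun hσ u hu => (h u hu).2.2.1 hσ, fun hσ u hu => (h u hu).2.2.2 hσ⟩

theorem goodStep_mono (σ : Semantics) (I : IAF V) (S : Finset V) (X : V → Prop) :
    Monotone (goodStep σ I S X) := by
  intro W W' h u hu
  refine ⟨hu.1, hu.2.1, hu.2.2.1, fun hσ => ?_⟩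
  obtain ⟨b, hb, hbu⟩ := hu.2.2.2 hσ
  exact ⟨b, h b hb, hbu⟩

theorem iterate_top_antitone {α : Type} [PartialOrder α] [OrderTop α] {f : α → α}
    (hf : Monotone f) (k : ℕ) : f^[k + 1] ⊤ ≤ f^[k] ⊤ := by
  rw [Function.iterate_succ_apply]
  exact hf.iterate k le_top

/-- A descending iteration on predicates over a finite type is stationary after as many steps as
there are elements. -/
theorem iterate_top_stable {V : Type} [Fintype V] {f : (V → Prop) → V → Prop} (hf : Monotone f) {N : ℕ}
    (hN : Fintype.card V ≤ N) : f (f^[N] ⊤) = f^[N] ⊤ := by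
  classical
  -- Until it is stationary, the descending iteration loses at least one element in each step.
  have key : ∀ k, f^[k + 1] ⊤ = f^[k] ⊤ ∨
      (Finset.univ.filter (f^[k] ⊤)).card + k ≤ Fintype.card V := by
    intro k
    induction k with
    | zero => exact .inr (by simpa using Finset.card_le_univ _)
    | succ k ih =>
      rcases ih with ih | ih
      · left
        rw [Function.iterate_succ_apply' f (k + 1), ih, ← Function.iterate_succ_apply' f k, ih]
      · by_cases h : f^[k + 1] ⊤ = f^[k] ⊤
        · left
          rw [Function.iterate_succ_apply' f (k + 1), h, ← Function.iterate_succ_apply' f k, h]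
        · right
          have hle := iterate_top_antitone hf k
          have hlt : (Finset.univ.filter (f^[k + 1] ⊤)).card <
              (Finset.univ.filter (f^[k] ⊤)).card := by
            refine Finset.card_lt_card ⟨fun u hu => ?_, fun hs => h ?_⟩
            · rw [Finset.mem_filter] at hu ⊢
              exact ⟨hu.1, hle u hu.2⟩
            · refine le_antisymm hle fun u hu => ?_
              exact (Finset.mem_filter.1 (hs (Finset.mem_filter.2 ⟨Finset.mem_univ u, hu⟩))).2
          omega
  have hcard : f^[Fintype.card V + 1] ⊤ = f^[Fintype.card V] ⊤ := by
    rcases key (Fintype.card V) with h | h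
    · exact h
    · have h₀ : Finset.univ.filter (f^[Fintype.card V] ⊤) = ∅ := by
        rw [← Finset.card_eq_zero]; omega
      refine le_antisymm (iterate_top_antitone hf _) fun u hu => ?_
      have : u ∈ Finset.univ.filter (f^[Fintype.card V] ⊤) :=
        Finset.mem_filter.2 ⟨Finset.mem_univ u, hu⟩
      rw [h₀] at this
      exact absurd this (Finset.notMem_empty u)
  obtain ⟨m, rfl⟩ := Nat.exists_eq_add_of_le hN
  induction m with
  | zero => rw [Nat.add_zero, ← Function.iterate_succ_apply' f]; exact hcard
  | succ m ih =>
    rw [← Nat.add_assoc, Function.iterate_succ_apply' f, ih (by omega), ih (by omega)]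

/-- `Check` and the inclusion of `Z` are preserved when `W` grows, so the largest good set is the
only candidate to be tested. -/
theorem verif_iff [Fintype V] {σ : Semantics} {I : IAF V} {S : Finset V} {X Y Z : V → Prop}
    {N : ℕ} (hN : Fintype.card V ≤ N) :
    Verif σ I S X Y Z ↔ Check I S Y ((goodStep σ I S X)^[N] ⊤) ∧
      ∀ u, Z u → (goodStep σ I S X)^[N] ⊤ u := by
  have hf := goodStep_mono σ I S X
  constructor
  · rintro ⟨W, hg, hc, hZ⟩
    have hle : ∀ k, W ≤ (goodStep σ I S X)^[k] ⊤ := by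
      intro k
      induction k with
      | zero => exact le_top
      | succ k ih =>
        rw [Function.iterate_succ_apply']
        exact (good_iff.1 hg).trans (hf ih)
    exact ⟨⟨hc.free, fun u hu huS huY huW => hc.out u hu huS huY fun h => huW (hle N u h)⟩,
      fun u hu => hle N u (hZ u hu)⟩
  · rintro ⟨hc, hZ⟩
    exact ⟨_, good_iff.2 (iterate_top_stable hf hN).ge, hc, hZ⟩

end Iterate

/-! ### Positions in encodings -/

/-- The bit of a word at a position, `false` beyond its end. -/
def bit (w : List Bool) (p : ℕ) : Bool := w[p]? == some true

theorem getElem?_flatMap_const {α : Type} {l : List α} {f : α → List Bool} {c : ℕ}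
    (hf : ∀ a, (f a).length = c) {i r : ℕ} (hi : i < l.length) (hr : r < c) :
    (l.flatMap f)[c * i + r]? = (f l[i])[r]? := by
  induction l generalizing i with
  | nil => simp at hi
  | cons a l ih =>
    rw [List.flatMap_cons]
    rcases i with _ | i
    · rw [List.getElem?_append_left (by rw [hf]; omega)]
      simp
    · rw [List.getElem?_append_right (by rw [hf, Nat.mul_succ]; omega), hf,
        show c * (i + 1) + r - c = c * i + r by rw [Nat.mul_succ]; omega]
      exact ih (by simpa using hi)

theorem length_flatMap_const {α : Type} {l : List α} {f : α → List Bool} {c : ℕ}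
    (hf : ∀ a, (f a).length = c) : (l.flatMap f).length = c * l.length := by
  induction l with
  | nil => simp
  | cons a l ih => rw [List.flatMap_cons, List.length_append, ih, hf, List.length_cons]; ring

/-- The four bits for an argument. -/
def Input.argBits (x : Input) (i : Fin x.n) : List Bool :=
  [decide (i ∈ x.I.A), decide (i ∈ x.I.AQ), decide (i ∈ x.S), decide (x.e = .inl i)]

/-- The three bits for a pair of arguments. -/
def Input.attBits (x : Input) (i k : Fin x.n) : List Bool :=
  [decide ((i, k) ∈ x.I.R), decide ((i, k) ∈ x.I.RQ), decide (x.e = .inr (i, k))]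

theorem Input.encode_eq (x : Input) :
    x.encode = [x.action.toBool] ++ ((List.replicate x.n true ++ [false]) ++
      ((List.finRange x.n).flatMap x.argBits ++
        (List.finRange x.n).flatMap fun i => (List.finRange x.n).flatMap (x.attBits i))) := by
  simp only [Input.encode, List.append_assoc]
  rfl

theorem Input.length_argPart (x : Input) :
    ((List.finRange x.n).flatMap x.argBits).length = 4 * x.n := by
  rw [length_flatMap_const (c := 4) fun _ => rfl, List.length_finRange]

theorem Input.length_attRow (x : Input) (i : Fin x.n) :
    ((List.finRange x.n).flatMap (x.attBits i)).length = 3 * x.n := by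
  rw [length_flatMap_const (c := 3) fun _ => rfl, List.length_finRange]

theorem Input.length_encode (x : Input) : x.encode.length = 2 + 5 * x.n + 3 * (x.n * x.n) := by
  rw [Input.encode_eq]
  simp only [List.length_append, x.length_argPart,
    length_flatMap_const (fun i => x.length_attRow i), List.length_finRange]
  simp
  ring

theorem Input.encode_action (x : Input) : x.encode[0]? = some x.action.toBool := by
  rw [Input.encode_eq]; rfl

theorem Input.encode_unary (x : Input) {m : ℕ} (hm : m < x.n) : x.encode[1 + m]? = some true := by
  rw [Input.encode_eq, List.getElem?_append_right (by simp), List.getElem?_append_left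
    (by simp; omega), List.getElem?_append_left (by simp; omega)]
  simp [hm]

theorem Input.encode_end (x : Input) : x.encode[1 + x.n]? = some false := by
  rw [Input.encode_eq, List.getElem?_append_right (by simp), List.getElem?_append_left
    (by simp), List.getElem?_append_right (by simp)]
  simp

theorem Input.encode_arg (x : Input) (i : Fin x.n) {c : ℕ} (hc : c < 4) :
    x.encode[2 + c + x.n + 4 * i]? = (x.argBits i)[c]? := by
  have h := i.isLt
  rw [Input.encode_eq, List.getElem?_append_right (by simp; omega), List.getElem?_append_right
    (by simp; omega), List.getElem?_append_left (by rw [x.length_argPart]; simp; omega)]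
  have := getElem?_flatMap_const (l := List.finRange x.n) (f := x.argBits) (c := 4) (fun _ => rfl)
    (i := i) (r := c) (by simp) hc
  rw [List.getElem_finRange] at this
  simp only [Fin.cast_mk, Fin.eta] at this
  rw [← this]
  congr 1
  simp
  omega

theorem Input.encode_att (x : Input) (i k : Fin x.n) {c : ℕ} (hc : c < 3) :
    x.encode[2 + c + 5 * x.n + 3 * (x.n * i + k)]? = (x.attBits i k)[c]? := by
  have h := i.isLt
  have h' := k.isLt
  rw [Input.encode_eq, List.getElem?_append_right (by simp; omega), List.getElem?_append_right
    (by simp; omega), List.getElem?_append_right (by rw [x.length_argPart]; simp; omega)]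
  have h₁ := getElem?_flatMap_const (l := List.finRange x.n)
    (f := fun i => (List.finRange x.n).flatMap (x.attBits i)) (c := 3 * x.n)
    (fun i => x.length_attRow i) (i := i) (r := 3 * k + c) (by simp) (by omega)
  have h₂ := getElem?_flatMap_const (l := List.finRange x.n) (f := x.attBits i) (c := 3)
    (fun _ => rfl) (i := k) (r := c) (by simp) hc
  rw [List.getElem_finRange] at h₁ h₂
  simp only [Fin.cast_mk, Fin.eta] at h₁ h₂
  rw [← h₂, ← h₁, x.length_argPart]
  congr 1
  simp
  ring_nf
  omega

/-- A word with the right header is determined by its bits for arguments and pairs. -/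
theorem Input.encode_eq_of_bits (x : Input) {w : List Bool}
    (hl : w.length = 2 + 5 * x.n + 3 * (x.n * x.n)) (h₀ : bit w 0 = x.action.toBool)
    (h₁ : ∀ m < x.n, bit w (1 + m) = true) (h₂ : bit w (1 + x.n) = false)
    (h₃ : ∀ (i : Fin x.n), ∀ c < 4, (x.argBits i)[c]? = some (bit w (2 + c + x.n + 4 * i)))
    (h₄ : ∀ (i k : Fin x.n), ∀ c < 3,
      (x.attBits i k)[c]? = some (bit w (2 + c + 5 * x.n + 3 * (x.n * i + k)))) :
    x.encode = w := by
  have hbit : ∀ p < w.length, w[p]? = some (bit w p) := by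
    intro p hp
    simp [bit, hp]
  refine List.ext_getElem? fun p => ?_
  by_cases hp : p < w.length
  swap
  · rw [List.getElem?_eq_none (by rw [x.length_encode, ← hl]; omega),
      List.getElem?_eq_none (by omega)]
  rw [hbit p hp]
  rcases Nat.eq_zero_or_pos p with rfl | hp₀
  · rw [x.encode_action, h₀]
  by_cases hp₁ : p < 1 + x.n
  · obtain ⟨m, rfl⟩ := Nat.exists_eq_add_of_le hp₀
    rw [x.encode_unary (by omega), h₁ m (by omega)]
  by_cases hp₂ : p = 1 + x.n
  · subst hp₂
    rw [x.encode_end, h₂]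
  by_cases hp₃ : p < 2 + 5 * x.n
  -- Past the header of `2 + n` bits, quotient and remainder by `4` give the argument name and the
  -- number of its bit.
  · have hq : (p - (2 + x.n)) / 4 < x.n := by omega
    have e : p = 2 + (p - (2 + x.n)) % 4 + x.n + 4 * (⟨_, hq⟩ : Fin x.n) := by
      simp only; omega
    have hm : (p - (2 + x.n)) % 4 < 4 := Nat.mod_lt _ (by omega)
    have := x.encode_arg ⟨_, hq⟩ hm
    rw [← e, h₃ _ _ hm, ← e] at this
    exact this
  · have hn : 0 < x.n := by
      rcases Nat.eq_zero_or_pos x.n with h | h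
      · rw [h] at hl hp₃; omega
      · exact h
    -- The pairs begin at `2 + 5 * n`. Division by `3` gives the number of the pair and of its bit,
    -- and division by `n` then gives row and column.
    have hq : (p - (2 + 5 * x.n)) / 3 < x.n * x.n := by omega
    have hi : (p - (2 + 5 * x.n)) / 3 / x.n < x.n := Nat.div_lt_of_lt_mul hq
    have hk : (p - (2 + 5 * x.n)) / 3 % x.n < x.n := Nat.mod_lt _ hn
    have hd := Nat.div_add_mod ((p - (2 + 5 * x.n)) / 3) x.n
    have e : p = 2 + (p - (2 + 5 * x.n)) % 3 + 5 * x.n +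
        3 * (x.n * (⟨_, hi⟩ : Fin x.n) + (⟨_, hk⟩ : Fin x.n)) := by
      simp only [hd]; omega
    have hm : (p - (2 + 5 * x.n)) % 3 < 3 := Nat.mod_lt _ (by omega)
    have := x.encode_att ⟨_, hi⟩ ⟨_, hk⟩ hm
    rw [← e, h₄ _ _ _ hm, ← e] at this
    exact this

end ArgFW

/-! ### Definability of encodings and of relevance by formulas -/

namespace ArgFW

open StackProg Fm

/-! ### Formulas over encodings -/

/-- The variables: the number of argument names, and six argument names. -/
abbrev Vr : Type := Option (Fin 6)

/-- Formulas over encodings. -/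
abbrev Form : Type := Fm Vr

/-- Truth. -/
def ttF : Form := .lt (.lit 0) (.lit 1)

/-- Negation. -/
def notF (φ : Form) : Form := .bin (fun a _ => !a) φ φ

/-- Conjunction. -/
def andF (φ ψ : Form) : Form := .bin and φ ψ

/-- Disjunction. -/
def orF (φ ψ : Form) : Form := .bin or φ ψ

/-- Implication. -/
def impF (φ ψ : Form) : Form := .bin (fun a b => !a || b) φ ψ

/-- Equality of terms. -/
def eqTm (a b : Tm Vr) : Form := andF (notF (.lt a b)) (notF (.lt b a))

/-- Equality of argument names. -/
def eqF (i k : Fin 6) : Form := eqTm (.var (some i)) (.var (some k))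

/-- There is an argument name with a property. -/
def exF (i : Fin 6) (φ : Form) : Form :=
  .ex (some i) (andF (.lt (.var (some i)) (.var none)) φ)

/-- All argument names have a property. -/
def allF (i : Fin 6) (φ : Form) : Form := notF (exF i (notF φ))

/-- The bit number `c` for an argument name. -/
def argF (c : ℕ) (i : Fin 6) : Form :=
  .inp (.add (.add (.lit (2 + c)) (.var none)) (.mul (.lit 4) (.var (some i))))

/-- The bit number `c` for a pair of argument names. -/
def attF (c : ℕ) (i k : Fin 6) : Form :=
  .inp (.add (.add (.lit (2 + c)) (.mul (.lit 5) (.var none)))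
    (.mul (.lit 3) (.add (.mul (.var none) (.var (some i))) (.var (some k)))))

/-- The bit of the array for an argument name. -/
def arrF (i : Fin 6) : Form := .arr (.var (some i))

/-- Values of the variables. -/
def asg {n : ℕ} (ρ : Fin 6 → Fin n) : Vr → ℕ
  | none => n
  | some i => ρ i

theorem update_asg {n : ℕ} (ρ : Fin 6 → Fin n) (i : Fin 6) (v : Fin n) :
    Function.update (asg ρ) (some i) (v : ℕ) = asg (Function.update ρ i v) := by
  funext j
  rcases j with _ | j
  · rfl
  · by_cases hj : j = i
    · subst hj; simp [asg]
    · simp [asg, hj]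

section Eval

variable {w : List Bool} {env : Vr → ℕ} {A : List Bool}

theorem eval_ttF : ttF.eval w env A = true := by simp [ttF, Fm.eval, Tm.eval]

theorem eval_notF {φ : Form} : (notF φ).eval w env A = true ↔ ¬ φ.eval w env A = true := by
  simp [notF, Fm.eval]

theorem eval_andF {φ ψ : Form} :
    (andF φ ψ).eval w env A = true ↔ φ.eval w env A = true ∧ ψ.eval w env A = true := by
  simp [andF, Fm.eval]

theorem eval_orF {φ ψ : Form} :
    (orF φ ψ).eval w env A = true ↔ φ.eval w env A = true ∨ ψ.eval w env A = true := by
  simp [orF, Fm.eval]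

theorem eval_impF {φ ψ : Form} :
    (impF φ ψ).eval w env A = true ↔ (φ.eval w env A = true → ψ.eval w env A = true) := by
  simp only [impF, Fm.eval]
  cases φ.eval w env A <;> simp

theorem eval_eqTm {a b : Tm Vr} :
    (eqTm a b).eval w env A = true ↔ a.eval w env = b.eval w env := by
  simp only [eqTm, eval_andF, eval_notF, Fm.eval, decide_eq_true_eq]
  omega

variable {n : ℕ} {ρ : Fin 6 → Fin n}

theorem eval_eqF {i k : Fin 6} : (eqF i k).eval w (asg ρ) A = true ↔ ρ i = ρ k := by
  rw [eqF, eval_eqTm]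
  exact Fin.ext_iff.symm

/-- Formula quantifiers range over numbers below the length of the word; `hn` guarantees that all
names are among them, and the guard in `exF` discards the rest. -/
theorem eval_exF (hn : n ≤ w.length) {i : Fin 6} {φ : Form} :
    (exF i φ).eval w (asg ρ) A = true ↔
      ∃ v, φ.eval w (asg (Function.update ρ i v)) A = true := by
  simp only [exF, Fm.eval, List.any_eq_true, List.mem_range]
  constructor
  · rintro ⟨v, -, h⟩
    rw [eval_andF] at h
    have hv : v < n := by simpa [Fm.eval, Tm.eval, asg] using h.1
    exact ⟨⟨v, hv⟩, by rw [← update_asg]; exact h.2⟩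
  · rintro ⟨v, h⟩
    refine ⟨v, by omega, ?_⟩
    rw [eval_andF, update_asg]
    exact ⟨by simp [Fm.eval, Tm.eval, asg], h⟩

theorem eval_allF (hn : n ≤ w.length) {i : Fin 6} {φ : Form} :
    (allF i φ).eval w (asg ρ) A = true ↔
      ∀ v, φ.eval w (asg (Function.update ρ i v)) A = true := by
  simp only [allF, eval_notF, eval_exF hn, not_exists, not_not]

theorem eval_argF {c : ℕ} {i : Fin 6} :
    (argF c i).eval w (asg ρ) A = bit w (2 + c + n + 4 * (ρ i : ℕ)) := rfl

theorem eval_attF {c : ℕ} {i k : Fin 6} : (attF c i k).eval w (asg ρ) A =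
    bit w (2 + c + 5 * n + 3 * (n * (ρ i : ℕ) + (ρ k : ℕ))) := rfl

theorem eval_arrF {i : Fin 6} : (arrF i).eval w (asg ρ) A = bit A (ρ i) := rfl

end Eval

/-! ### Recognizing encodings -/

/-- The word has a header for the number of names, and the right length. -/
def headerF : Form :=
  andF (eqTm .len (.add (.add (.lit 2) (.mul (.lit 5) (.var none)))
      (.mul (.lit 3) (.mul (.var none) (.var none)))))
    (andF (allF 0 (.inp (.add (.lit 1) (.var (some 0))))) (notF (.inp (.add (.lit 1) (.var none)))))

/-- The bits describe an incomplete framework and a set of its arguments. -/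
def iafF : Form :=
  andF (allF 0 (andF (notF (andF (argF 0 0) (argF 1 0)))
      (andF (impF (argF 2 0) (orF (argF 0 0) (argF 1 0))) (impF (argF 3 0) (argF 1 0)))))
    (allF 0 (allF 1 (andF (notF (andF (attF 0 0 1) (attF 1 0 1)))
      (andF (impF (orF (attF 0 0 1) (attF 1 0 1))
          (andF (orF (argF 0 0) (argF 1 0)) (orF (argF 0 1) (argF 1 1))))
        (impF (attF 2 0 1) (attF 1 0 1))))))

/-- Exactly one element is marked. -/
def markF : Form :=
  orF
    (exF 0 (andF (argF 3 0) (andF (allF 1 (impF (argF 3 1) (eqF 1 0)))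
      (allF 1 (allF 2 (notF (attF 2 1 2)))))))
    (exF 0 (exF 1 (andF (attF 2 0 1)
      (andF (allF 2 (allF 3 (impF (attF 2 2 3) (andF (eqF 2 0) (eqF 3 1)))))
        (allF 2 (notF (argF 3 2)))))))

/-- The word is an encoding. -/
def encF : Form := andF headerF (andF iafF markF)

section Encoding

variable {x : Input} {A : List Bool} {ρ : Fin 6 → Fin x.n} {i k : Fin 6}

theorem Input.n_le_length (x : Input) : x.n ≤ x.encode.length := by
  rw [x.length_encode]; omega

theorem bit_eq {w : List Bool} {p : ℕ} {b : Bool} (h : w[p]? = some b) : bit w p = b := by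
  rw [bit, h]; cases b <;> rfl

theorem eval_certArg : (argF 0 i).eval x.encode (asg ρ) A = true ↔ ρ i ∈ x.I.A := by
  rw [eval_argF, bit_eq (x.encode_arg (ρ i) (c := 0) (by omega)), decide_eq_true_eq]

theorem eval_possArg : (argF 1 i).eval x.encode (asg ρ) A = true ↔ ρ i ∈ x.I.AQ := by
  rw [eval_argF, bit_eq (x.encode_arg (ρ i) (c := 1) (by omega)), decide_eq_true_eq]

theorem eval_memS : (argF 2 i).eval x.encode (asg ρ) A = true ↔ ρ i ∈ x.S := by
  rw [eval_argF, bit_eq (x.encode_arg (ρ i) (c := 2) (by omega)), decide_eq_true_eq]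

theorem eval_markArg : (argF 3 i).eval x.encode (asg ρ) A = true ↔ x.e = .inl (ρ i) := by
  rw [eval_argF, bit_eq (x.encode_arg (ρ i) (c := 3) (by omega)), decide_eq_true_eq]

theorem eval_certAtt : (attF 0 i k).eval x.encode (asg ρ) A = true ↔ (ρ i, ρ k) ∈ x.I.R := by
  rw [eval_attF, bit_eq (x.encode_att (ρ i) (ρ k) (c := 0) (by omega)), decide_eq_true_eq]

theorem eval_possAtt : (attF 1 i k).eval x.encode (asg ρ) A = true ↔ (ρ i, ρ k) ∈ x.I.RQ := by
  rw [eval_attF, bit_eq (x.encode_att (ρ i) (ρ k) (c := 1) (by omega)), decide_eq_true_eq]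

theorem eval_markAtt :
    (attF 2 i k).eval x.encode (asg ρ) A = true ↔ x.e = .inr (ρ i, ρ k) := by
  rw [eval_attF, bit_eq (x.encode_att (ρ i) (ρ k) (c := 2) (by omega)), decide_eq_true_eq]

theorem eval_encF_encode : encF.eval x.encode (asg ρ) A = true := by
  have hn := x.n_le_length
  have hd := Finset.disjoint_left.1 x.I.disjoint_args
  have hd' := Finset.disjoint_left.1 x.I.disjoint_atts
  have hS := x.S_subset
  have he := x.e_mem
  rw [encF, eval_andF, eval_andF]
  refine ⟨?_, ?_, ?_⟩
  · rw [headerF, eval_andF, eval_andF, eval_eqTm, eval_allF hn, eval_notF]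
    refine ⟨by simp [Tm.eval, asg, x.length_encode], fun v => ?_, ?_⟩
    · simpa [bit, Fm.eval, Tm.eval, asg] using bit_eq (x.encode_unary v.isLt)
    · simpa [bit, Fm.eval, Tm.eval, asg] using bit_eq x.encode_end
  · simp only [iafF, eval_andF, eval_allF hn, eval_notF, eval_impF, eval_orF, eval_certArg,
      eval_possArg, eval_memS, eval_markArg, eval_certAtt, eval_possAtt, eval_markAtt]
    refine ⟨fun v => ⟨fun h => hd h.1 h.2, fun h => ?_, fun h => ?_⟩,
      fun u v => ⟨fun h => hd' h.1 h.2, fun h => ?_, fun h => ?_⟩⟩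
    · simpa using hS h
    · rw [h] at he
      simpa [IAF.uncertain] using he
    · rw [← Finset.mem_union] at h
      have := Finset.mem_product.1 (Finset.union_subset x.I.R_subset x.I.RQ_subset h)
      simpa only [Finset.mem_union] using this
    · rw [h] at he
      simpa [IAF.uncertain] using he
  · simp only [markF, eval_andF, eval_allF hn, eval_exF hn, eval_notF, eval_impF, eval_orF,
      eval_markArg, eval_markAtt, eval_eqF]
    rcases hx : x.e with a | ⟨a, b⟩
    · refine .inl ⟨a, ?_⟩
      simp
    · refine .inr ⟨a, b, ?_⟩
      simp [eq_comm]

/-- A word described by `encF` is the encoding of an input. -/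
theorem exists_encode_eq {w : List Bool} {n : ℕ} (hn : n ≤ w.length) {ρ : Fin 6 → Fin n}
    (h : encF.eval w (asg ρ) A = true) : ∃ x : Input, x.n = n ∧ x.encode = w := by
  classical
  rw [encF, eval_andF, eval_andF, headerF, eval_andF, eval_andF, eval_eqTm, eval_allF hn,
    eval_notF] at h
  simp only [iafF, markF, eval_andF, eval_allF hn, eval_exF hn, eval_notF, eval_impF, eval_orF,
    eval_argF, eval_attF, eval_eqF] at h
  simp +decide only [Function.update_self, ne_eq,
    Function.update_of_ne] at h
  obtain ⟨⟨hl, h₁, h₂⟩, ⟨hi, hk⟩, he⟩ := h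
  let arg (c : ℕ) (i : Fin n) : Bool := bit w (2 + c + n + 4 * (i : ℕ))
  let att (c : ℕ) (i k : Fin n) : Bool := bit w (2 + c + 5 * n + 3 * (n * (i : ℕ) + (k : ℕ)))
  -- Since exactly one element is marked, the marking bits are the characteristic vector and matrix
  -- of a single `e`.
  obtain ⟨e, hel, her⟩ : ∃ e : Fin n ⊕ Fin n × Fin n, (∀ i, arg 3 i = decide (e = .inl i)) ∧
      ∀ i k, att 2 i k = decide (e = .inr (i, k)) := by
    rcases he with ⟨a, ha, hu, hn'⟩ | ⟨a, b, ha, hu, hn'⟩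
    · refine ⟨.inl a, fun i => ?_, fun i k => ?_⟩
      · rw [Bool.eq_iff_iff, decide_eq_true_eq, Sum.inl.injEq]
        exact ⟨fun h => (hu i h).symm, fun h => h ▸ ha⟩
      · simpa using hn' i k
    · refine ⟨.inr (a, b), fun i => ?_, fun i k => ?_⟩
      · simpa using hn' i
      · rw [Bool.eq_iff_iff, decide_eq_true_eq, Sum.inr.injEq, Prod.mk.injEq]
        refine ⟨fun h => ⟨(hu i k h).1.symm, (hu i k h).2.symm⟩, ?_⟩
        rintro ⟨rfl, rfl⟩
        exact ha
  let x : Input :=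
    { n := n
      I :=
        { A := Finset.univ.filter fun i => arg 0 i = true
          AQ := Finset.univ.filter fun i => arg 1 i = true
          R := Finset.univ.filter fun r => att 0 r.1 r.2 = true
          RQ := Finset.univ.filter fun r => att 1 r.1 r.2 = true
          disjoint_args := by
            rw [Finset.disjoint_left]
            simp only [Finset.mem_filter, Finset.mem_univ, true_and]
            exact fun i h h' => (hi i).1 ⟨h, h'⟩
          disjoint_atts := by
            rw [Finset.disjoint_left]
            simp only [Finset.mem_filter, Finset.mem_univ, true_and]
            exact fun r h h' => (hk r.1 r.2).1 ⟨h, h'⟩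
          R_subset := by
            intro r hr
            simp only [Finset.mem_filter, Finset.mem_univ, true_and, Finset.mem_product,
              Finset.mem_union] at hr ⊢
            exact (hk r.1 r.2).2.1 (.inl hr)
          RQ_subset := by
            intro r hr
            simp only [Finset.mem_filter, Finset.mem_univ, true_and, Finset.mem_product,
              Finset.mem_union] at hr ⊢
            exact (hk r.1 r.2).2.1 (.inr hr) }
      S := Finset.univ.filter fun i => arg 2 i = true
      S_subset := by
        intro i
        simp only [Finset.mem_filter, Finset.mem_univ, true_and, Finset.mem_union]
        exact (hi i).2.1
      action := if bit w 0 then .addition else .removal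
      e := e
      e_mem := by
        rcases e with a | ⟨a, b⟩
        · simp only [IAF.uncertain, Finset.inl_mem_disjSum, Finset.mem_filter, Finset.mem_univ,
            true_and]
          exact (hi a).2.2 ((hel a).trans (by simp))
        · simp only [IAF.uncertain, Finset.inr_mem_disjSum, Finset.mem_filter, Finset.mem_univ,
            true_and]
          exact (hk a b).2.2 ((her a b).trans (by simp)) }
  refine ⟨x, rfl, x.encode_eq_of_bits hl ?_ ?_ ?_ ?_ ?_⟩
  · simp only [x]
    cases bit w 0 <;> rfl
  · intro m hm
    simpa [Fm.eval, Tm.eval, asg, bit] using h₁ ⟨m, hm⟩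
  · simpa [Fm.eval, Tm.eval, asg, bit] using h₂
  · intro i c hc
    interval_cases c
    · simp [Input.argBits, x, arg]
    · simp [Input.argBits, x, arg]
    · simp [Input.argBits, x, arg]
    · simpa [Input.argBits, x] using (hel i).symm
  · intro i k c hc
    interval_cases c
    · simp [Input.attBits, x, att]
    · simp [Input.attBits, x, att]
    · simpa [Input.attBits, x] using (her i k).symm

end Encoding

end ArgFW

namespace ArgFW

open StackProg Fm

/-! ### The formula for relevance -/

/-- A certain or uncertain attack. -/
def possF (i k : Fin 6) : Form := orF (attF 0 i k) (attF 1 i k)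

/-- The formula for a decided property of the semantics. -/
def propF (p : Prop) [Decidable p] : Form := if p then ttF else notF ttF

instance : DecidableEq Semantics := fun a b => by
  cases a <;> cases b <;> first | exact isTrue rfl | exact isFalse (by simp)

/-- The step of the iteration towards the largest good set, for the variable `3`. -/
def stepF (σ : Semantics) (X : Form) : Form :=
  andF (andF (orF (argF 0 3) (argF 1 3)) (andF (notF (argF 2 3))
      (allF 4 (impF (argF 2 4) (andF (notF (attF 0 4 3)) (notF (attF 0 3 4)))))))
    (andF (notF X) (andF (propF (σ ≠ .st))
      (impF (propF (σ = .co)) (exF 4 (andF (arrF 4) (possF 4 3))))))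

/-- The formula for `Verif`, the sets being given by formulas with the variable `3`. -/
def verifF (σ : Semantics) (X Y Z : Form) : Form :=
  .iter (some 3) (stepF σ X)
    (andF (andF (allF 3 (impF (argF 2 3) (allF 4 (impF (argF 2 4) (notF (attF 0 3 4))))))
      (allF 3 (impF (argF 0 3) (impF (notF (argF 2 3)) (impF (notF Y) (impF (notF (arrF 3))
        (exF 4 (andF (argF 2 4) (possF 4 3)))))))))
    (allF 3 (impF Z (arrF 3))))

/-- The formula for `PossExt`. -/
def possExtF (σ : Semantics) : Form := verifF σ (notF ttF) (notF ttF) (notF ttF)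

/-- The formula for `PossUndec`. -/
def possUndecF (σ : Semantics) (i : Fin 6) : Form := verifF σ (notF ttF) (notF ttF) (eqF 3 i)

/-- The formula for `PossSole`. -/
def possSoleF (i k : Fin 6) : Form :=
  andF (possF i k) (verifF .co (andF (notF (eqF 3 i)) (attF 0 3 k)) (notF ttF)
    (orF (eqF 3 i) (eqF 3 k)))

/-- The formula for `PossBlock`. -/
def possBlockF (σ : Semantics) (k : Fin 6) : Form :=
  andF (notF (argF 2 k)) (andF (allF 3 (impF (argF 2 3) (notF (attF 0 3 k))))
    (orF
      (andF (orF (propF (σ = .st)) (exF 3 (andF (argF 2 3) (possF k 3))))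
        (verifF σ (eqF 3 k) (eqF 3 k) (notF ttF)))
      (andF (propF (σ = .co)) (andF (notF (attF 0 k k))
        (verifF σ (orF (eqF 3 k) (attF 0 3 k)) (eqF 3 k) (notF ttF))))))

/-- The formula for `AddCrit`. -/
def addF (σ : Semantics) : Form :=
  orF
    (exF 0 (andF (argF 3 0) (orF (andF (argF 2 0) (possExtF σ)) (andF (notF (argF 2 0))
      (andF (propF (σ = .co)) (exF 1 (andF (notF (eqF 1 0)) (possSoleF 0 1))))))))
    (exF 0 (exF 1 (andF (attF 2 0 1) (orF (andF (argF 2 0) (possBlockF σ 1))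
      (andF (notF (argF 2 0)) (andF (notF (argF 2 1)) (andF (propF (σ = .co))
        (possSoleF 0 1))))))))

/-- The formula for `RemCrit`. -/
def remF (σ : Semantics) : Form :=
  orF (exF 0 (andF (argF 3 0) (possBlockF σ 0)))
    (exF 0 (exF 1 (andF (attF 2 0 1) (orF (andF (argF 2 0) (andF (argF 2 1) (possExtF σ)))
      (orF (andF (argF 2 0) (andF (notF (argF 2 1)) (andF (propF (σ = .co))
          (exF 2 (andF (notF (eqF 2 1)) (possSoleF 1 2))))))
        (andF (notF (argF 2 0)) (andF (argF 2 1) (possUndecF σ 0))))))))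

/-- The formula for the relevance problem. -/
def relevanceF (σ : Semantics) (v : Bool) : Form :=
  .ex none (andF encF
    (orF (andF (.inp (.lit 0)) (if v then addF σ else remF σ))
      (andF (notF (.inp (.lit 0))) (if v then remF σ else addF σ))))

section Eval

variable {x : Input} {A : List Bool} {ρ : Fin 6 → Fin x.n} {i k : Fin 6}

theorem eval_propF {w : List Bool} {env : Vr → ℕ} {p : Prop} [Decidable p] :
    (propF p).eval w env A = true ↔ p := by
  by_cases h : p <;> simp [propF, h, eval_ttF, eval_notF]

theorem eval_possF :
    (possF i k).eval x.encode (asg ρ) A = true ↔ (ρ i, ρ k) ∈ x.I.R ∪ x.I.RQ := by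
  rw [possF, eval_orF, eval_certAtt, eval_possAtt, Finset.mem_union]

theorem eval_stepF {σ : Semantics} {XF : Form} {X W : Fin x.n → Prop}
    (hX : XF.eval x.encode (asg ρ) A = true ↔ X (ρ 3)) (hW : ∀ v : Fin x.n, bit A v = true ↔ W v) :
    (stepF σ XF).eval x.encode (asg ρ) A = true ↔ goodStep σ x.I x.S X W (ρ 3) := by
  simp +decide only [stepF, goodStep, eval_andF, eval_orF, eval_notF, eval_impF,
    eval_allF x.n_le_length, eval_exF x.n_le_length, eval_certArg, eval_possArg, eval_memS,
    eval_certAtt, eval_possF, eval_propF, eval_arrF, hX, hW, Function.update_self, ne_eq,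
    Function.update_of_ne, Finset.mem_union]

/-- As many rounds as the word has bits are enough, since there are at most that many names. The
parameter formulas may not depend on the array, because they are evaluated while it changes. -/
theorem eval_verifF {σ : Semantics} {XF YF ZF : Form} {X Y Z : Fin x.n → Prop}
    (hX : ∀ v B, XF.eval x.encode (asg (Function.update ρ 3 v)) B = true ↔ X v)
    (hY : ∀ v B, YF.eval x.encode (asg (Function.update ρ 3 v)) B = true ↔ Y v)
    (hZ : ∀ v B, ZF.eval x.encode (asg (Function.update ρ 3 v)) B = true ↔ Z v) :
    (verifF σ XF YF ZF).eval x.encode (asg ρ) A = true ↔ Verif σ x.I x.S X Y Z := by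
  have hn := x.n_le_length
  rw [verif_iff (N := x.encode.length) (by simpa using hn), verifF, Fm.eval]
  generalize hN : x.encode.length = N at hn
  set F : List Bool → List Bool := fun B => (List.range N).map fun v =>
    (stepF σ XF).eval x.encode (Function.update (asg ρ) (some 3) v) (B ++ A) with hF
  have hlen : ∀ m, (F^[m] (List.replicate N true)).length = N := by
    intro m
    rcases m with _ | m
    · simp
    · rw [Function.iterate_succ_apply']; simp [hF]
  -- The array is longer than the number of names; only its entries at names are compared with the
  -- iteration, and only those are ever read.
  have hbit : ∀ m (v : Fin x.n), bit (F^[m] (List.replicate N true) ++ A) v = true ↔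
      (goodStep σ x.I x.S X)^[m] ⊤ v := by
    intro m
    induction m with
    | zero =>
      intro v
      have := v.isLt
      simp [bit, List.getElem?_append, show (v : ℕ) < N by omega]
    | succ m ih =>
      intro v
      have := v.isLt
      rw [Function.iterate_succ_apply', Function.iterate_succ_apply']
      have hv : (v : ℕ) < N := by omega
      generalize hB : F^[m] (List.replicate N true) = B at ih ⊢
      have hs : bit (F B ++ A) v = (stepF σ XF).eval x.encode
          (asg (Function.update ρ 3 v)) (B ++ A) := by
        rw [← update_asg]
        simp [bit, hF, List.getElem?_append, hv]
      rw [hs, eval_stepF (W := (goodStep σ x.I x.S X)^[m] ⊤) (X := X) (by simpa using hX v _) ih]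
      simp
  have hb := hbit N
  generalize F^[N] (List.replicate N true) ++ A = B at hb ⊢
  have hc : ∀ W, Check x.I x.S Y W ↔ (∀ s ∈ x.S, ∀ s' ∈ x.S, (s, s') ∉ x.I.R) ∧
      ∀ u ∈ x.I.A, u ∉ x.S → ¬ Y u → ¬ W u → ∃ s ∈ x.S, (s, u) ∈ x.I.R ∪ x.I.RQ :=
    fun W => ⟨fun h => ⟨h.free, h.out⟩, fun h => ⟨h.1, h.2⟩⟩
  rw [hc]
  simp +decide only [eval_andF, eval_notF, eval_impF, eval_allF x.n_le_length,
    eval_exF x.n_le_length, eval_certArg, eval_memS, eval_certAtt, eval_possF, eval_arrF, hY, hZ,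
    hb, Function.update_self, ne_eq, Function.update_of_ne]

theorem eval_falseF {w : List Bool} {env : Vr → ℕ} :
    (notF ttF).eval w env A = true ↔ False := by
  simp [eval_notF, eval_ttF]

theorem eval_possExtF {σ : Semantics} :
    (possExtF σ).eval x.encode (asg ρ) A = true ↔ PossExt σ x.I x.S :=
  eval_verifF (fun _ _ => eval_falseF) (fun _ _ => eval_falseF) fun _ _ => eval_falseF

/-- The formula `verifF` binds the variable `3` around its parameters, so `i` must be another
variable. The variable `4` is bound only in subformulas that do not contain the parameters. -/
theorem eval_possUndecF {σ : Semantics} (hi : i ≠ 3) :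
    (possUndecF σ i).eval x.encode (asg ρ) A = true ↔ PossUndec σ x.I x.S (ρ i) :=
  eval_verifF (fun _ _ => eval_falseF) (fun _ _ => eval_falseF) fun _ _ => by
    simp [eval_eqF, hi]

theorem eval_possSoleF (hi : i ≠ 3) (hk : k ≠ 3) :
    (possSoleF i k).eval x.encode (asg ρ) A = true ↔ PossSole x.I x.S (ρ i) (ρ k) := by
  rw [possSoleF, eval_andF, eval_possF, PossSole, eval_verifF]
  · intro v B
    simp [eval_andF, eval_notF, eval_eqF, eval_certAtt, hi, hk]
  · exact fun _ _ => eval_falseF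
  · intro v B
    simp [eval_orF, eval_eqF, hi, hk]

theorem eval_possBlockF {σ : Semantics} (hk : k ≠ 3) :
    (possBlockF σ k).eval x.encode (asg ρ) A = true ↔ PossBlock σ x.I x.S (ρ k) := by
  have h₁ : ∀ v B, (eqF 3 k).eval x.encode (asg (Function.update ρ 3 v)) B = true ↔ v = ρ k := by
    simp [eval_eqF, hk]
  have h₂ : ∀ v B, (orF (eqF 3 k) (attF 0 3 k)).eval x.encode (asg (Function.update ρ 3 v)) B =
      true ↔ v = ρ k ∨ (v, ρ k) ∈ x.I.R := by
    simp [eval_orF, eval_eqF, eval_certAtt, hk]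
  simp only [possBlockF, PossBlock, eval_andF, eval_notF, eval_orF, eval_impF,
    eval_allF x.n_le_length, eval_exF x.n_le_length, eval_memS, eval_certAtt, eval_possF,
    eval_propF, eval_verifF h₁ h₁ (fun _ _ => eval_falseF),
    eval_verifF h₂ h₁ (fun _ _ => eval_falseF), Function.update_self, ne_eq, hk,
    not_false_eq_true, Function.update_of_ne]

theorem eval_addF {σ : Semantics} :
    (addF σ).eval x.encode (asg ρ) A = true ↔ AddCrit σ x.I x.S x.e := by
  have h₁ : (0 : Fin 6) ≠ 3 := by decide
  have h₂ : (1 : Fin 6) ≠ 3 := by decide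
  have h₃ : (0 : Fin 6) ≠ 1 := by decide
  simp only [addF, eval_andF, eval_notF, eval_orF, eval_exF x.n_le_length, eval_markArg,
    eval_markAtt, eval_memS, eval_possExtF, eval_possSoleF h₁ h₂, eval_possBlockF h₂, eval_propF,
    eval_eqF, Function.update_self, Function.update_of_ne h₃]
  rcases x.e with a | ⟨a, b⟩
  · simp only [Sum.inl.injEq, exists_eq_left', reduceCtorEq, false_and, exists_false, or_false]
    exact Iff.rfl
  · simp [AddCrit]

theorem eval_remF {σ : Semantics} :
    (remF σ).eval x.encode (asg ρ) A = true ↔ RemCrit σ x.I x.S x.e := by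
  have h₁ : (0 : Fin 6) ≠ 3 := by decide
  have h₂ : (1 : Fin 6) ≠ 3 := by decide
  have h₃ : (0 : Fin 6) ≠ 1 := by decide
  have h₄ : (2 : Fin 6) ≠ 3 := by decide
  have h₅ : (1 : Fin 6) ≠ 2 := by decide
  simp only [remF, eval_andF, eval_notF, eval_orF, eval_exF x.n_le_length, eval_markArg,
    eval_markAtt, eval_memS, eval_possExtF, eval_possUndecF h₁, eval_possSoleF h₂ h₄,
    eval_possBlockF h₁, eval_propF, eval_eqF, Function.update_self, Function.update_of_ne h₃,
    Function.update_of_ne h₅]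
  rcases x.e with a | ⟨a, b⟩
  · simp [RemCrit]
  · simp [RemCrit]

theorem relevant_iff_crit {σ : Semantics} {v : Bool} :
    Relevant ⟨σ, v⟩ x.I x.S x.action x.e ↔
      x.action.toBool = true ∧ (if v then AddCrit σ x.I x.S x.e else RemCrit σ x.I x.S x.e) ∨
      ¬ x.action.toBool = true ∧
        (if v then RemCrit σ x.I x.S x.e else AddCrit σ x.I x.S x.e) := by
  cases v
  · rw [relevant_false_iff, relevant_true_iff x.S_subset x.e_mem]
    cases x.action <;> simp [Act.toBool, Act.opposite]
  · rw [relevant_true_iff x.S_subset x.e_mem]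
    cases x.action <;> simp [Act.toBool]

theorem eval_critF {σ : Semantics} {v : Bool} :
    (orF (andF (.inp (.lit 0)) (if v then addF σ else remF σ))
        (andF (notF (.inp (.lit 0))) (if v then remF σ else addF σ))).eval x.encode (asg ρ) A =
      true ↔ Relevant ⟨σ, v⟩ x.I x.S x.action x.e := by
  have h : ((Fm.inp (.lit 0) : Form).eval x.encode (asg ρ) A = true) ↔
      x.action.toBool = true := by
    rw [← bit_eq x.encode_action]; rfl
  rw [relevant_iff_crit, eval_orF, eval_andF, eval_andF, eval_notF, h]
  cases v <;> simp [eval_addF, eval_remF]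

/-- With no names no element can be marked. This case is separate because `asg` assigns names to all
six variables and so needs at least one name. -/
theorem not_eval_markF {w A : List Bool} {env : Vr → ℕ} (h : env none = 0) :
    ¬ markF.eval w env A = true := by
  simp [markF, eval_orF, eval_andF, exF, Fm.eval, Tm.eval, Function.update, h]

/-- The outer quantifier guesses the number of names. `encF` confirms that the word encodes an input
with this number, and on encodings the remaining formula expresses relevance. -/
theorem eval_relevanceF {σ : Semantics} {v : Bool} {w : List Bool} :
    (relevanceF σ v).eval w (fun _ => 0) [] = true ↔ w ∈ relevanceProblem ⟨σ, v⟩ := by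
  have henv : ∀ {n : ℕ} (hn : 0 < n), Function.update (fun _ : Vr => 0) none n =
      asg (fun _ => (⟨0, hn⟩ : Fin n)) := by
    intro n hn
    funext j
    rcases j with _ | j <;> simp [asg]
  rw [relevanceF, Fm.eval, List.any_eq_true]
  constructor
  · rintro ⟨n, hn, h⟩
    rw [List.mem_range] at hn
    rw [eval_andF] at h
    rcases Nat.eq_zero_or_pos n with rfl | hpos
    · have h' := h.1
      rw [encF, eval_andF, eval_andF] at h'
      exact absurd h'.2.2 (not_eval_markF (by simp))
    · rw [henv hpos] at h
      obtain ⟨x, rfl, rfl⟩ := exists_encode_eq hn.le h.1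
      exact ⟨x, rfl, eval_critF.1 h.2⟩
  · rintro ⟨x, rfl, hx⟩
    -- The uncertain element `e` of the input supplies a name.
    have hpos : 0 < x.n := by
      rcases x.e with a | ⟨a, -⟩ <;> exact a.pos
    refine ⟨x.n, ?_, ?_⟩
    · rw [List.mem_range, x.length_encode]
      omega
    · rw [henv hpos, eval_andF]
      exact ⟨eval_encF_encode, eval_critF.2 hx⟩

end Eval

end ArgFW

theorem corollary3 (σ : ArgFW.Semantics) (v : Bool) :
    ArgFW.InP (ArgFW.relevanceProblem ⟨σ, v⟩) :=
  ⟨fun w => (ArgFW.relevanceF σ v).eval w (fun _ => 0) [], fun _ => ArgFW.eval_relevanceF,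
    (ArgFW.relevanceF σ v).computable⟩
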